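/- Let $(\Omega,\Sigma,\mu)$ be a finite measure space, let $L^0(\Omega)$ be the algebra of classes (modulo a.e. equality) of complex measurable functions on $\Omega$, and let $E\subseteq L^0(\Omega)$ be a faithful solid subalgebra: a complex subalgebra containing the unit $\mathbf 1$ such that $|f|\le|g|$, $f\in L^0(\Omega)$, $g\in E$ imply $f\in E$, and such that $E^\perp=\{0\}$. Let $\nabla$ be the Boolean algebra of idempotents of $E$. A net $(a_\alpha)$ in $E$ $(o)$-converges to $a\in E$ if there is a nonempty downward directed set $D\subseteq E$ with infimum $0$ such that for every $d\in D$ one has $|a_\alpha-a|\le d$ for all sufficiently large $\alpha$. Let $\mathcal U$ be a unital Banach–Kantorovich algebra over $E$, i.e. an associative complex algebra with unit $e$ that is a (unital) module over the algebra $E$ with $(au)v=a(uv)=u(av)$ for $a\in E$, $u,v\in\mathcal U$, equipped with an $E$-valued norm $\|\cdot\|$, that is, a map into the nonnegative elements of $E$ such that, for $u,v\in\mathcal U$, $\lambda\in\mathbb C$, $a\in E$: $\|u\|=0$ iff $u=0$; $\|\lambda u\|=|\lambda|\,\|u\|$; $\|au\|=|a|\,\|u\|$; $\|u+v\|\le\|u\|+\|v\|$;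 $\|uv\|\le\|u\|\,\|v\|$; $\|e\|=\mathbf 1$; such that $\mathcal U$ is $d$-decomposable (if $\|u\|=\lambda_1+\lambda_2$ with $\lambda_1,\lambda_2\ge0$ and $\lambda_1\lambda_2=0$, then $u=u_1+u_2$ with $\|u_k\|=\lambda_k$) and $(bo)$-complete (every net $(u_\alpha)$ with $\|u_\alpha-u_\beta\|\xrightarrow{(o)}0$ has some $u\in\mathcal U$ with $\|u_\alpha-u\|\xrightarrow{(o)}0$). For $\pi\in\nabla$, $\pi\ne0$, regard $\pi\mathcal U=\{\pi u:u\in\mathcal U\}$ as an algebra with unit $\pi e$, and for $x\in\mathcal U$ let $$\mathrm{spm}(x)=\{a\in E:\ \pi(ae-x)\text{ is not invertible in }\pi\mathcal U\text{ for every }\pi\in\nabla,\ \pi\neq0\}.$$ **Theorem.** For every $x\in\mathcal U$ the set $\mathrm{spm}(x)$ is - nonempty; - $(o)$-closed: if a net of elements of $\mathrm{spm}(x)$ $(o)$-converges to $a\in E$, then $a\in\mathrm{spm}(x)$; - cyclic: for every sequence $(a_n)$ in $\mathrm{spm}(x)$ and every countable partition of unity $(\pi_n)$ in $\nabla$ (pairwise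 disjoint idempotents with supremum $\mathbf 1$), the $(o)$-convergent sum $\sum_n\pi_na_n$ exists in $E$ and belongs to $\mathrm{spm}(x)$; - bounded in $E$: $|a|\le\|x\|$ for every $a\in\mathrm{spm}(x)$. -/

import Mathlib

open MeasureTheory Filter

noncomputable section

namespace BanachKantorovich

universe u v

section L0

variable {Ω : Type u} [MeasurableSpace Ω] {μ : Measure Ω}

/-- `L⁰` is a commutative ring under the pointwise a.e. operations. -/
instance instCommRingL0 {γ : Type v} [TopologicalSpace γ] [CommRing γ] [IsTopologicalRing γ] :
    CommRing (Ω →ₘ[μ] γ) :=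
  { (AEEqFun.instAddCommGroup : AddCommGroup (Ω →ₘ[μ] γ)),
    (AEEqFun.instCommMonoid : CommMonoid (Ω →ₘ[μ] γ)) with
    left_distrib := fun a b c => by
      induction a, b, c using AEEqFun.induction_on₃ with
      | _ a ha b hb c hc =>
        simp only [AEEqFun.mk_add_mk, AEEqFun.mk_mul_mk, AEEqFun.mk_eq_mk]
        exact Eventually.of_forall fun w => mul_add (a w) (b w) (c w)
    right_distrib := fun a b c => by
      induction a, b, c using AEEqFun.induction_on₃ with
      | _ a ha b hb c hc =>
        simp only [AEEqFun.mk_add_mk, AEEqFun.mk_mul_mk, AEEqFun.mk_eq_mk]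
        exact Eventually.of_forall fun w => add_mul (a w) (b w) (c w)
    zero_mul := fun a => by
      induction a using AEEqFun.induction_on with
      | _ a ha =>
        simp only [AEEqFun.zero_def, AEEqFun.mk_mul_mk, AEEqFun.mk_eq_mk]
        exact Eventually.of_forall fun w => zero_mul (a w)
    mul_zero := fun a => by
      induction a using AEEqFun.induction_on with
      | _ a ha =>
        simp only [AEEqFun.zero_def, AEEqFun.mk_mul_mk, AEEqFun.mk_eq_mk]
        exact Eventually.of_forall fun w => mul_zero (a w) }

/-- `L⁰(Ω)` is a complex algebra. -/
instance instAlgebraL0 : Algebra ℂ (Ω →ₘ[μ] ℂ) :=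
  Algebra.ofModule
    (fun r a b => by
      induction a, b using AEEqFun.induction_on₂ with
      | _ a ha b hb =>
        simp only [AEEqFun.smul_mk, AEEqFun.mk_mul_mk, AEEqFun.mk_eq_mk]
        exact Eventually.of_forall fun w => smul_mul_assoc r (a w) (b w))
    (fun r a b => by
      induction a, b using AEEqFun.induction_on₂ with
      | _ a ha b hb =>
        simp only [AEEqFun.smul_mk, AEEqFun.mk_mul_mk, AEEqFun.mk_eq_mk]
        exact Eventually.of_forall fun w => mul_smul_comm r (a w) (b w))

/-- The modulus `|f|` of a class `f ∈ L⁰(Ω)` of complex measurable functions, as a class of real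
measurable functions. -/
def modulus (f : Ω →ₘ[μ] ℂ) : Ω →ₘ[μ] ℝ :=
  AEEqFun.comp (fun z : ℂ => ‖z‖) continuous_norm f

/-- The inclusion of the real classes into the complex space `L⁰(Ω)`. -/
def toComplex (f : Ω →ₘ[μ] ℝ) : Ω →ₘ[μ] ℂ :=
  AEEqFun.comp (fun r : ℝ => (r : ℂ)) Complex.continuous_ofReal f

/-- `E` is a faithful solid subalgebra of `L⁰(Ω)`. (A `Subalgebra` contains the unit `1`.) -/
structure IsFaithfulSolid (E : Subalgebra ℂ (Ω →ₘ[μ] ℂ)) : Prop where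
  /-- solid: `|f| ≤ |g|` and `g ∈ E` imply `f ∈ E` -/
  solid : ∀ f g : Ω →ₘ[μ] ℂ, modulus f ≤ modulus g → g ∈ E → f ∈ E
  /-- faithful: `E^⊥ = {0}`, where `f ⊥ g` means `|f| ∧ |g| = 0` -/
  faithful : ∀ f : Ω →ₘ[μ] ℂ, (∀ g ∈ E, modulus f ⊓ modulus g = 0) → f = 0

/-- A family `f` of nonnegative classes (indexed by a set with a filter `l`; for a net, `l` is the
filter `atTop` of its directed index set) order converges to `0` in `E`: there is a downward
directed set `D` of elements of `E` with infimum `0` each of which eventually dominates the family.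
As `E` is solid, the infimum may be taken in `L⁰` or in `E`. -/
def OTendstoZero (E : Subalgebra ℂ (Ω →ₘ[μ] ℂ)) {ι : Type v} (f : ι → Ω →ₘ[μ] ℝ)
    (l : Filter ι) : Prop :=
  ∃ D : Set (Ω →ₘ[μ] ℝ), D.Nonempty ∧ DirectedOn (fun c d => d ≤ c) D ∧
    (∀ d ∈ D, toComplex d ∈ E) ∧ IsGLB D 0 ∧ ∀ d ∈ D, ∀ᶠ i in l, f i ≤ d

/-- `(o)`-convergence in `E` of a family `f` along `l` to `a`. -/
def OTendsto (E : Subalgebra ℂ (Ω →ₘ[μ] ℂ)) {ι : Type v} (f : ι → E) (l : Filter ι) (a : E) :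
    Prop :=
  OTendstoZero E (fun i => modulus ((f i - a : E) : Ω →ₘ[μ] ℂ)) l

/-- `S ⊆ E` is `(o)`-closed: it contains the `(o)`-limits in `E` of the nets in `S`. Nets are
expressed by filters (a net is represented by the filter of its tails). -/
def IsOClosed (E : Subalgebra ℂ (Ω →ₘ[μ] ℂ)) (S : Set E) : Prop :=
  ∀ (l : Filter E) (a : E), l.NeBot → (∀ᶠ b in l, b ∈ S) → OTendsto E (fun b => b) l a → a ∈ S

/-- A countable partition of unity in the Boolean algebra `∇` of idempotents of `E`: pairwise
disjoint idempotents whose supremum in `∇` is `1` (the order of `∇` being `p ≤ q ↔ p * q = p`). -/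
structure IsPartitionOfUnity (E : Subalgebra ℂ (Ω →ₘ[μ] ℂ)) (p : ℕ → E) : Prop where
  orthogonal : OrthogonalIdempotents p
  sup_eq_one : ∀ q : E, IsIdempotentElem q → (∀ n, p n * q = p n) → q = 1

/-- `S ⊆ E` is cyclic: for every sequence `(aₙ)` in `S` and every countable partition of unity
`(pₙ)`, the `(o)`-sum `∑ pₙ aₙ` exists in `E` and belongs to `S`. -/
def IsCyclicSet (E : Subalgebra ℂ (Ω →ₘ[μ] ℂ)) (S : Set E) : Prop :=
  ∀ (a p : ℕ → E), (∀ n, a n ∈ S) → IsPartitionOfUnity E p →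
    ∃ b ∈ S, OTendsto E (fun k => ∑ n ∈ Finset.range k, p n * a n) atTop b

end L0

section Algebra

variable {Ω : Type u} [MeasurableSpace Ω] {μ : Measure Ω}

/-- `N` is an `E`-valued norm on the complex linear space `U` which is an `E`-module. -/
structure IsLatticeNorm (E : Subalgebra ℂ (Ω →ₘ[μ] ℂ)) {U : Type v} [AddCommGroup U]
    [Module ℂ U] [Module E U] (N : U → Ω →ₘ[μ] ℝ) : Prop where
  mem : ∀ u, toComplex (N u) ∈ E
  nonneg : ∀ u, 0 ≤ N u
  eq_zero_iff : ∀ u, N u = 0 ↔ u = 0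
  smul_complex : ∀ (c : ℂ) (u : U), N (c • u) = ‖c‖ • N u
  smul : ∀ (a : E) (u : U), N (a • u) = modulus (a : Ω →ₘ[μ] ℂ) * N u
  add_le : ∀ u v, N (u + v) ≤ N u + N v

/-- `(U, N)` is a Banach–Kantorovich space over `E`: `d`-decomposable and `(bo)`-complete. -/
structure IsBanachKantorovichSpace (E : Subalgebra ℂ (Ω →ₘ[μ] ℂ)) {U : Type v} [AddCommGroup U]
    [Module ℂ U] [Module E U] (N : U → Ω →ₘ[μ] ℝ) : Prop extends IsLatticeNorm E N where
  decomposable : ∀ (u : U) (r s : Ω →ₘ[μ] ℝ), 0 ≤ r → 0 ≤ s → r * s = 0 → N u = r + s →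
    ∃ v w : U, u = v + w ∧ N v = r ∧ N w = s
  /-- Every `(bo)`-fundamental net, expressed by the filter `l` of its tails, is
  `(bo)`-convergent. -/
  complete : ∀ l : Filter U, l.NeBot → OTendstoZero E (fun q : U × U => N (q.1 - q.2)) (l ×ˢ l) →
    ∃ u : U, OTendstoZero E (fun w : U => N (w - u)) l

/-- `(U, N)` is a unital Banach–Kantorovich algebra over `E`. The actions of `ℂ` and `E` are
compatible with each other and with the product: `(a u) v = a (u v) = u (a v)`. -/
structure IsUnitalBanachKantorovichAlgebra (E : Subalgebra ℂ (Ω →ₘ[μ] ℂ)) {U : Type v} [Ring U]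
    [Algebra ℂ U] [Module E U] [IsScalarTower ℂ E U] [IsScalarTower E U U] [SMulCommClass E U U]
    (N : U → Ω →ₘ[μ] ℝ) : Prop extends IsBanachKantorovichSpace E N where
  mul_le : ∀ u v, N (u * v) ≤ N u * N v
  one : N 1 = 1

/-- `πU = {π u : u ∈ U}`. -/
def corner {E : Subalgebra ℂ (Ω →ₘ[μ] ℂ)} (U : Type v) [Ring U] [Module E U] (π : E) : Set U :=
  Set.range (fun u : U => π • u)

/-- `z ∈ Inv(πU)`: `z` is an invertible element of the algebra `πU`, whose unit is `π e`. -/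
def IsInvIn {E : Subalgebra ℂ (Ω →ₘ[μ] ℂ)} {U : Type v} [Ring U] [Module E U] (π : E) (z : U) :
    Prop :=
  z ∈ corner U π ∧ ∃ y ∈ corner U π, z * y = π • (1 : U) ∧ y * z = π • (1 : U)

/-- The mixed spectrum `spm(x)`. -/
def spm (E : Subalgebra ℂ (Ω →ₘ[μ] ℂ)) {U : Type v} [Ring U] [Module E U] (x : U) : Set E :=
  {a | ∀ π : E, IsIdempotentElem π → π ≠ 0 → ¬ IsInvIn π (π • (a • (1 : U) - x))}

end Algebra

end BanachKantorovich

end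

/-! Elements of `E` are handled through representatives, and the nonzero idempotents are the
indicators of non-null measurable sets, so invertibility in a corner means invertibility over a set.
The elements of `pU` with essentially bounded norm form a complex Banach algebra under the essential
supremum; completeness comes from `(bo)`-completeness. This yields Neumann series in corners and
nonempty ordinary spectra.

Nonemptiness requires choosing a spectral value measurably in the point. A disc of constants is
called free over a set if the resolvent exists there with one bound for the whole disc. Boundedness
matters: only bounded inverses lie in the Banach algebra. Where `N x ≤ R`, the disc of radius `R` is
free over no non-null subset, since it contains the spectrum of a bounded restriction of `x`. By
compactness a disc is covered by finitely many discs of half its radius, or of radius one at the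
root. If all of these were free over pieces covering a non-null set, finitely many intersections
would make the large disc free over a non-null set. So almost every point has a branch of non-free
discs with radii `(1 / 2) ^ n` and centres in a fixed dense sequence, and it can be chosen
measurably (`exists_measurable_branch`). The limit of the centres is the required `a`: if `a • 1 -
x` were invertible over some non-null set, `InvOn.perturb` would make a disc of the branch free over
a non-null set on which the branch uses it.

The norm bound is a Neumann series where `N x < |a|`, closedness is stability of invertibility, and
cyclicity holds because invertibility passes to smaller idempotents. -/

noncomputable section

namespace BanachKantorovich

/-! ### Representatives of elements of `E`; idempotents as indicators -/

section FaithfulSolid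

variable {Ω : Type*} [MeasurableSpace Ω] {μ : Measure Ω}

lemma coeFn_modulus (f : Ω →ₘ[μ] ℂ) : ∀ᵐ ω ∂μ, modulus f ω = ‖f ω‖ :=
  AEEqFun.coeFn_comp _ _ _

lemma coeFn_toComplex (f : Ω →ₘ[μ] ℝ) : ∀ᵐ ω ∂μ, toComplex f ω = (f ω : ℂ) :=
  AEEqFun.coeFn_comp _ _ _

variable {E : Subalgebra ℂ (Ω →ₘ[μ] ℂ)}

/-- A representative of an element of `E`. -/
def rep (a : E) : Ω → ℂ := ((a : Ω →ₘ[μ] ℂ) : Ω → ℂ)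

lemma measurable_rep (a : E) : Measurable (rep a) := AEEqFun.measurable _

lemma rep_ext {a b : E} (h : ∀ᵐ ω ∂μ, rep a ω = rep b ω) : a = b :=
  Subtype.ext (AEEqFun.ext h)

lemma rep_add (a b : E) : ∀ᵐ ω ∂μ, rep (a + b) ω = rep a ω + rep b ω :=
  AEEqFun.coeFn_add (a : Ω →ₘ[μ] ℂ) b

lemma rep_sub (a b : E) : ∀ᵐ ω ∂μ, rep (a - b) ω = rep a ω - rep b ω :=
  AEEqFun.coeFn_sub (a : Ω →ₘ[μ] ℂ) b

lemma rep_mul (a b : E) : ∀ᵐ ω ∂μ, rep (a * b) ω = rep a ω * rep b ω :=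
  AEEqFun.coeFn_mul (a : Ω →ₘ[μ] ℂ) b

lemma rep_one : ∀ᵐ ω ∂μ, rep (1 : E) ω = 1 :=
  AEEqFun.coeFn_one (α := Ω) (β := ℂ) (μ := μ)

lemma rep_zero : ∀ᵐ ω ∂μ, rep (0 : E) ω = 0 :=
  AEEqFun.coeFn_zero (α := Ω) (β := ℂ) (μ := μ)

lemma rep_smul (c : ℂ) (a : E) : ∀ᵐ ω ∂μ, rep (c • a) ω = c * rep a ω :=
  AEEqFun.coeFn_smul c (a : Ω →ₘ[μ] ℂ)

lemma rep_smul_one (c : ℂ) : ∀ᵐ ω ∂μ, rep (c • 1 : E) ω = c := by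
  filter_upwards [rep_smul c (1 : E), rep_one (E := E)] with ω h1 h2
  rw [h1, h2, mul_one]

lemma rep_finset_sum {ι : Type*} (s : Finset ι) (f : ι → E) :
    ∀ᵐ ω ∂μ, rep (∑ i ∈ s, f i) ω = ∑ i ∈ s, rep (f i) ω := by
  classical
  induction s using Finset.induction_on with
  | empty => simpa using rep_zero (E := E)
  | insert i s hi ih =>
    filter_upwards [rep_add (f i) (∑ i ∈ s, f i), ih] with ω h1 h2
    rw [Finset.sum_insert hi, Finset.sum_insert hi, h1, h2]

lemma coeFn_modulus_rep (a : E) : ∀ᵐ ω ∂μ, modulus (a : Ω →ₘ[μ] ℂ) ω = ‖rep a ω‖ :=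
  coeFn_modulus _

/-- A measurable function dominated by an element of `E` represents an element of `E`. -/
lemma IsFaithfulSolid.exists_rep (hE : IsFaithfulSolid E) {f : Ω → ℂ} (hf : AEMeasurable f μ)
    (g : E) (h : ∀ᵐ ω ∂μ, ‖f ω‖ ≤ ‖rep g ω‖) : ∃ a : E, ∀ᵐ ω ∂μ, rep a ω = f ω := by
  have hm : (AEEqFun.mk f hf.aestronglyMeasurable : Ω →ₘ[μ] ℂ) ∈ E := by
    refine hE.solid _ g ?_ g.2
    rw [← AEEqFun.coeFn_le]
    filter_upwards [coeFn_modulus (AEEqFun.mk f hf.aestronglyMeasurable : Ω →ₘ[μ] ℂ),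
      coeFn_modulus_rep g, AEEqFun.coeFn_mk f hf.aestronglyMeasurable, h] with ω h1 h2 h3 h4
    rw [h1, h2, h3]
    exact h4
  exact ⟨⟨_, hm⟩, AEEqFun.coeFn_mk f hf.aestronglyMeasurable⟩

lemma IsFaithfulSolid.exists_rep_of_bdd (hE : IsFaithfulSolid E) {f : Ω → ℂ}
    (hf : AEMeasurable f μ) (C : ℝ) (h : ∀ᵐ ω ∂μ, ‖f ω‖ ≤ C) :
    ∃ a : E, ∀ᵐ ω ∂μ, rep a ω = f ω := by
  refine hE.exists_rep hf ((C : ℂ) • 1) ?_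
  filter_upwards [rep_smul_one (E := E) (C : ℂ), h] with ω h1 h2
  rw [h1, Complex.norm_real, Real.norm_eq_abs]
  exact h2.trans (le_abs_self C)

lemma IsFaithfulSolid.exists_indicator (hE : IsFaithfulSolid E) {A : Set Ω}
    (hA : MeasurableSet A) : ∃ a : E, ∀ᵐ ω ∂μ, rep a ω = A.indicator 1 ω := by
  refine hE.exists_rep_of_bdd (measurable_one.indicator hA).aemeasurable 1 (.of_forall fun ω => ?_)
  by_cases h : ω ∈ A <;> simp [h]

/-- The idempotent of `E` given by a measurable set. -/
def chi (hE : IsFaithfulSolid E) {A : Set Ω} (hA : MeasurableSet A) : E :=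
  (hE.exists_indicator hA).choose

variable (hE : IsFaithfulSolid E) {A B : Set Ω} (hA : MeasurableSet A) (hB : MeasurableSet B)

lemma rep_chi : ∀ᵐ ω ∂μ, rep (chi hE hA) ω = A.indicator 1 ω :=
  (hE.exists_indicator hA).choose_spec

lemma chi_mul_chi (h : B ⊆ A) : chi hE hB * chi hE hA = chi hE hB := by
  refine rep_ext ?_
  filter_upwards [rep_mul (chi hE hB) (chi hE hA), rep_chi hE hA, rep_chi hE hB] with ω h1 h2 h3
  rw [h1, h2, h3]
  by_cases hb : ω ∈ B
  · simp [hb, h hb]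
  · simp [hb]

lemma isIdempotentElem_chi : IsIdempotentElem (chi hE hA) := chi_mul_chi hE hA hA subset_rfl

lemma chi_ne_zero (h : μ A ≠ 0) : chi hE hA ≠ 0 := by
  intro h0
  refine h (measure_eq_zero_iff_ae_notMem.2 ?_)
  filter_upwards [rep_chi hE hA, rep_zero (E := E)] with ω h1 h2 hω
  rw [h0, h2] at h1
  simp [hω] at h1

/-- A representative of an idempotent takes only the values 0 and 1 almost everywhere. -/
lemma exists_eq_chi {p : E} (hp : IsIdempotentElem p) (h0 : p ≠ 0) :
    ∃ (A : Set Ω) (hA : MeasurableSet A), μ A ≠ 0 ∧ p = chi hE hA := by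
  have hA : MeasurableSet {ω | rep p ω = 1} := measurable_rep p (measurableSet_singleton 1)
  have key : p = chi hE hA := by
    refine rep_ext ?_
    filter_upwards [rep_mul p p, rep_chi hE hA] with ω h1 h2
    rw [hp.eq] at h1
    rw [h2]
    by_cases h : rep p ω = 1
    · simp [h]
    · rw [Set.indicator_of_notMem (by exact h)]
      by_contra h3
      exact h (mul_left_cancel₀ h3 (by rw [← h1, mul_one]))
  refine ⟨_, hA, fun h => h0 ?_, key⟩
  rw [key]
  refine rep_ext ?_
  filter_upwards [rep_chi hE hA, rep_zero (E := E), measure_eq_zero_iff_ae_notMem.1 h]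
    with ω h1 h2 h3
  rw [h1, h2, Set.indicator_of_notMem (by exact h3)]

end FaithfulSolid

/-- Countable subadditivity. It turns an index depending on the point into a constant one, at the
price of a smaller non-null set. -/
lemma exists_measure_inter_ne_zero {Ω : Type*} [MeasurableSpace Ω] {μ : Measure Ω} {ι : Type*}
    [Countable ι] {A : Set Ω} (hA : μ A ≠ 0) {S : ι → Set Ω}
    (h : ∀ᵐ ω ∂μ, ω ∈ A → ∃ n, ω ∈ S n) : ∃ n, μ (A ∩ S n) ≠ 0 := by
  by_contra! hc
  refine hA (measure_eq_zero_iff_ae_notMem.2 ?_)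
  have : ∀ᵐ ω ∂μ, ∀ n, ω ∉ A ∩ S n := ae_all_iff.2 fun n => measure_eq_zero_iff_ae_notMem.1 (hc n)
  filter_upwards [h, this] with ω h1 h2 hω
  obtain ⟨n, hn⟩ := h1 hω
  exact h2 n ⟨hω, hn⟩

/-! ### The `E`-valued norm read pointwise almost everywhere -/

section Norm

variable {Ω : Type*} [MeasurableSpace Ω] {μ : Measure Ω} {E : Subalgebra ℂ (Ω →ₘ[μ] ℂ)}

section Lattice

variable {U : Type*} [AddCommGroup U] [Module ℂ U] [Module E U] {N : U → Ω →ₘ[μ] ℝ}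
  (hN : IsLatticeNorm E N)

include hN

lemma IsLatticeNorm.ae_nonneg (u : U) : ∀ᵐ ω ∂μ, 0 ≤ N u ω := by
  filter_upwards [AEEqFun.coeFn_le.2 (hN.nonneg u),
    AEEqFun.coeFn_zero (α := Ω) (β := ℝ) (μ := μ)] with ω h1 h2
  rw [h2] at h1
  exact h1

lemma IsLatticeNorm.ae_smul (a : E) (u : U) : ∀ᵐ ω ∂μ, N (a • u) ω = ‖rep a ω‖ * N u ω := by
  rw [hN.smul]
  filter_upwards [AEEqFun.coeFn_mul (modulus (a : Ω →ₘ[μ] ℂ)) (N u), coeFn_modulus_rep a]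
    with ω h1 h2
  rw [h1, Pi.mul_apply, h2]

lemma IsLatticeNorm.ae_smul_complex (c : ℂ) (u : U) : ∀ᵐ ω ∂μ, N (c • u) ω = ‖c‖ * N u ω := by
  rw [hN.smul_complex]
  filter_upwards [AEEqFun.coeFn_smul ‖c‖ (N u)] with ω h1
  rw [h1, Pi.smul_apply, smul_eq_mul]

lemma IsLatticeNorm.ae_add_le (u v : U) : ∀ᵐ ω ∂μ, N (u + v) ω ≤ N u ω + N v ω := by
  filter_upwards [AEEqFun.coeFn_add (N u) (N v), AEEqFun.coeFn_le.2 (hN.add_le u v)] with ω h1 h2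
  rw [h1] at h2
  exact h2

lemma IsLatticeNorm.ae_neg (u : U) : ∀ᵐ ω ∂μ, N (-u) ω = N u ω := by
  filter_upwards [hN.ae_smul_complex (-1) u] with ω h
  rw [neg_one_smul] at h
  simpa using h

lemma IsLatticeNorm.ae_sub_le (u v : U) : ∀ᵐ ω ∂μ, N (u - v) ω ≤ N u ω + N v ω := by
  rw [sub_eq_add_neg]
  filter_upwards [hN.ae_add_le u (-v), hN.ae_neg v] with ω h1 h2
  rw [h2] at h1
  exact h1

lemma IsLatticeNorm.ae_zero : ∀ᵐ ω ∂μ, N 0 ω = 0 := by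
  rw [(hN.eq_zero_iff 0).2 rfl]
  exact AEEqFun.coeFn_zero

lemma IsLatticeNorm.eq_zero_of_ae {u : U} (h : ∀ᵐ ω ∂μ, N u ω ≤ 0) : u = 0 := by
  refine (hN.eq_zero_iff u).1 (AEEqFun.ext ?_)
  filter_upwards [h, hN.ae_nonneg u, AEEqFun.coeFn_zero (α := Ω) (β := ℝ) (μ := μ)]
    with ω h1 h2 h3
  rw [h3]
  exact le_antisymm h1 h2

end Lattice

variable {U : Type*} [Ring U] [Algebra ℂ U] [Module E U] [IsScalarTower ℂ E U]
  [IsScalarTower E U U] [SMulCommClass E U U] {N : U → Ω →ₘ[μ] ℝ}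

lemma idem_smul_smul {U : Type*} [AddCommGroup U] [Module E U] {p : E} (hp : IsIdempotentElem p) (u : U) : p • p • u = p • u := by
  rw [smul_smul, hp.eq]

section

variable (hN : IsUnitalBanachKantorovichAlgebra E N)

include hN

lemma IsUnitalBanachKantorovichAlgebra.ae_mul_le (u v : U) :
    ∀ᵐ ω ∂μ, N (u * v) ω ≤ N u ω * N v ω := by
  filter_upwards [AEEqFun.coeFn_mul (N u) (N v), AEEqFun.coeFn_le.2 (hN.mul_le u v)] with ω h1 h2
  rw [h1] at h2
  exact h2

lemma IsUnitalBanachKantorovichAlgebra.ae_one : ∀ᵐ ω ∂μ, N (1 : U) ω = 1 := by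
  rw [hN.one]
  exact AEEqFun.coeFn_one

lemma IsUnitalBanachKantorovichAlgebra.ae_smul_one (a : E) :
    ∀ᵐ ω ∂μ, N (a • (1 : U)) ω = ‖rep a ω‖ := by
  filter_upwards [hN.ae_smul a 1, hN.ae_one] with ω h1 h2
  rw [h1, h2, mul_one]

end

/-- The elements of `pU` with bounded norm. -/
def bddCorner (hN : IsUnitalBanachKantorovichAlgebra E N) (p : E) : Submodule ℂ U where
  carrier := {u | p • u = u ∧ ∃ C : ℝ, ∀ᵐ ω ∂μ, N u ω ≤ C}
  add_mem' := by
    rintro u v ⟨hu, C, hC⟩ ⟨hv, D, hD⟩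
    refine ⟨by rw [smul_add, hu, hv], C + D, ?_⟩
    filter_upwards [hC, hD, hN.ae_add_le u v] with ω h1 h2 h3
    linarith
  zero_mem' := ⟨smul_zero _, 0, hN.ae_zero.mono fun _ h => h.le⟩
  smul_mem' := by
    rintro c u ⟨hu, C, hC⟩
    refine ⟨?_, ‖c‖ * C, ?_⟩
    · have h : ∀ v : U, c • v = (c • 1 : E) • v := fun v => by rw [smul_assoc, one_smul]
      rw [h u, smul_smul, mul_comm, ← smul_smul, hu]
    · filter_upwards [hC, hN.ae_smul_complex c u] with ω h1 h2
      rw [h2]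
      exact mul_le_mul_of_nonneg_left h1 (norm_nonneg c)

/-- The elements of `pU` with bounded norm, as a type which carries a Banach algebra structure. -/
def BddCorner (hN : IsUnitalBanachKantorovichAlgebra E N) {p : E} (_ : IsIdempotentElem p) :
    Type _ := bddCorner hN p

/-! ### The normed algebra of bounded elements of a corner -/

namespace BddCorner

variable {hN : IsUnitalBanachKantorovichAlgebra E N} {p : E} {hp : IsIdempotentElem p}

instance : AddCommGroup (BddCorner hN hp) := inferInstanceAs (AddCommGroup (bddCorner hN p))

instance : Module ℂ (BddCorner hN hp) := inferInstanceAs (Module ℂ (bddCorner hN p))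

/-- The underlying element of `U`. -/
def val (u : BddCorner hN hp) : U := Subtype.val u

lemma val_injective : Function.Injective (val : BddCorner hN hp → U) := Subtype.val_injective

lemma smul_val (u : BddCorner hN hp) : p • u.val = u.val := u.2.1

lemma exists_bound (u : BddCorner hN hp) : ∃ C : ℝ, ∀ᵐ ω ∂μ, N u.val ω ≤ C := u.2.2

lemma exists_val_eq {u : U} (h : p • u = u) {C : ℝ} (hC : ∀ᵐ ω ∂μ, N u ω ≤ C) :
    ∃ w : BddCorner hN hp, w.val = u := ⟨⟨u, h, C, hC⟩, rfl⟩

@[simp] lemma val_sub (u v : BddCorner hN hp) : (u - v).val = u.val - v.val := rfl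

lemma val_neg (u : BddCorner hN hp) : (-u).val = -u.val := rfl

@[simp] lemma val_smul (c : ℂ) (u : BddCorner hN hp) : (c • u).val = c • u.val := rfl

instance : Mul (BddCorner hN hp) where
  mul u v := ⟨u.val * v.val, by rw [← smul_mul_assoc, u.smul_val], by
    obtain ⟨C, hC⟩ := u.exists_bound
    obtain ⟨D, hD⟩ := v.exists_bound
    refine ⟨C * D, ?_⟩
    filter_upwards [hC, hD, hN.ae_mul_le u.val v.val, hN.ae_nonneg u.val, hN.ae_nonneg v.val]
      with ω h1 h2 h3 h4 h5
    exact h3.trans (mul_le_mul h1 h2 h5 (h4.trans h1))⟩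

lemma norm_rep_idem_le (hp : IsIdempotentElem p) : ∀ᵐ ω ∂μ, ‖rep p ω‖ ≤ 1 := by
  filter_upwards [rep_mul p p] with ω h
  rw [hp.eq] at h
  by_contra! hc
  have h2 : ‖rep p ω‖ = ‖rep p ω‖ * ‖rep p ω‖ := by rw [← norm_mul, ← h]
  nlinarith

instance : One (BddCorner hN hp) where
  one := ⟨p • 1, idem_smul_smul hp 1, 1, by
    filter_upwards [hN.ae_smul_one p, norm_rep_idem_le hp] with ω h1 h2
    rw [h1]
    exact h2⟩

@[simp] lemma val_mul (u v : BddCorner hN hp) : (u * v).val = u.val * v.val := rfl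

@[simp] lemma val_one : (1 : BddCorner hN hp).val = p • 1 := rfl

instance : Ring (BddCorner hN hp) :=
  { (inferInstance : AddCommGroup (BddCorner hN hp)) with
    left_distrib := fun _ _ _ => val_injective (mul_add _ _ _)
    right_distrib := fun _ _ _ => val_injective (add_mul _ _ _)
    zero_mul := fun _ => val_injective (zero_mul _)
    mul_zero := fun _ => val_injective (mul_zero _)
    mul_assoc := fun _ _ _ => val_injective (mul_assoc _ _ _)
    one_mul := fun u => val_injective (by
      rw [val_mul, val_one, smul_mul_assoc, one_mul, smul_val])
    mul_one := fun u => val_injective (by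
      rw [val_mul, val_one, mul_smul_comm, mul_one, smul_val]) }

instance : Algebra ℂ (BddCorner hN hp) :=
  Algebra.ofModule (fun c u v => val_injective (smul_mul_assoc c u.val v.val))
    (fun c u v => val_injective (mul_smul_comm c u.val v.val))

/-- The least bound of the norm. -/
def bound (u : BddCorner hN hp) : ℝ := sInf {C : ℝ | 0 ≤ C ∧ ∀ᵐ ω ∂μ, N u.val ω ≤ C}

lemma bound_nonneg (u : BddCorner hN hp) : 0 ≤ u.bound := Real.sInf_nonneg fun _ h => h.1

lemma bound_le {u : BddCorner hN hp} {C : ℝ} (hC : 0 ≤ C) (h : ∀ᵐ ω ∂μ, N u.val ω ≤ C) :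
    u.bound ≤ C := csInf_le ⟨0, fun _ h => h.1⟩ ⟨hC, h⟩

/-- The infimum is attained, because countably many almost sure bounds hold simultaneously. -/
lemma ae_le_bound (u : BddCorner hN hp) : ∀ᵐ ω ∂μ, N u.val ω ≤ u.bound := by
  have hne : {C : ℝ | 0 ≤ C ∧ ∀ᵐ ω ∂μ, N u.val ω ≤ C}.Nonempty := by
    obtain ⟨C, hC⟩ := u.exists_bound
    exact ⟨max C 0, le_max_right _ _, hC.mono fun ω h => h.trans (le_max_left _ _)⟩
  have h : ∀ n : ℕ, ∀ᵐ ω ∂μ, N u.val ω ≤ u.bound + 1 / ((n : ℝ) + 1) := fun n => by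
    obtain ⟨C, ⟨_, hC⟩, hlt⟩ := exists_lt_of_csInf_lt hne
      (lt_add_of_pos_right u.bound (Nat.one_div_pos_of_nat (α := ℝ) (n := n)))
    exact hC.mono fun ω h => h.trans hlt.le
  filter_upwards [ae_all_iff.2 h] with ω hω
  have ht : Tendsto (fun n : ℕ => u.bound + 1 / ((n : ℝ) + 1)) atTop (nhds (u.bound + 0)) :=
    tendsto_one_div_add_atTop_nhds_zero_nat.const_add _
  rw [add_zero] at ht
  exact ge_of_tendsto' ht hω

instance : NormedAddCommGroup (BddCorner hN hp) :=
  AddGroupNorm.toNormedAddCommGroup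
    { toFun := bound
      map_zero' := le_antisymm (bound_le le_rfl (hN.ae_zero.mono fun _ h => h.le))
        (bound_nonneg _)
      add_le' := fun u v => bound_le (add_nonneg u.bound_nonneg v.bound_nonneg) (by
        filter_upwards [u.ae_le_bound, v.ae_le_bound, hN.ae_add_le u.val v.val] with ω h1 h2 h3
        exact h3.trans (add_le_add h1 h2))
      neg' := fun u => by
        have h : {C : ℝ | 0 ≤ C ∧ ∀ᵐ ω ∂μ, N (-u).val ω ≤ C} =
            {C : ℝ | 0 ≤ C ∧ ∀ᵐ ω ∂μ, N u.val ω ≤ C} := by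
          ext C
          refine and_congr_right fun _ => eventually_congr ?_
          filter_upwards [hN.ae_neg u.val] with ω h
          rw [val_neg, h]
        unfold bound
        rw [h]
      eq_zero_of_map_eq_zero' := fun u h => val_injective (hN.eq_zero_of_ae (by
        filter_upwards [u.ae_le_bound] with ω h1
        exact h1.trans_eq h)) }

lemma norm_le_of_ae {u : BddCorner hN hp} {C : ℝ} (hC : 0 ≤ C) (h : ∀ᵐ ω ∂μ, N u.val ω ≤ C) :
    ‖u‖ ≤ C := bound_le hC h

lemma ae_le_norm (u : BddCorner hN hp) : ∀ᵐ ω ∂μ, N u.val ω ≤ ‖u‖ := ae_le_bound u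

instance : NormedRing (BddCorner hN hp) :=
  { (inferInstance : NormedAddCommGroup (BddCorner hN hp)),
    (inferInstance : Ring (BddCorner hN hp)) with
    norm_mul_le := fun u v => norm_le_of_ae (mul_nonneg (norm_nonneg u) (norm_nonneg v)) (by
      filter_upwards [u.ae_le_norm, v.ae_le_norm, hN.ae_mul_le u.val v.val, hN.ae_nonneg u.val,
        hN.ae_nonneg v.val] with ω h1 h2 h3 h4 h5
      exact h3.trans (mul_le_mul h1 h2 h5 (h4.trans h1))) }

instance : NormedAlgebra ℂ (BddCorner hN hp) where
  norm_smul_le c u := norm_le_of_ae (mul_nonneg (norm_nonneg c) (norm_nonneg u)) (by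
    filter_upwards [u.ae_le_norm, hN.ae_smul_complex c u.val] with ω h1 h2
    rw [val_smul, h2]
    exact mul_le_mul_of_nonneg_left h1 (norm_nonneg c))

lemma norm_one_le : ‖(1 : BddCorner hN hp)‖ ≤ 1 := norm_le_of_ae zero_le_one (by
  filter_upwards [hN.ae_smul_one p, norm_rep_idem_le hp] with ω h1 h2
  rw [val_one, h1]
  exact h2)

lemma nontrivial (h : p ≠ 0) : Nontrivial (BddCorner hN hp) := by
  refine ⟨1, 0, fun h0 => h (rep_ext ?_)⟩
  have h1 : p • (1 : U) = 0 := congrArg val h0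
  filter_upwards [hN.ae_smul_one p, hN.ae_zero, rep_zero (E := E)] with ω h2 h3 h4
  rw [h1, h3] at h2
  rw [h4]
  exact norm_eq_zero.1 h2.symm

end BddCorner

end Norm

/-! ### Order convergence and completeness of the bounded corner -/

section Complete

variable {Ω : Type*} [MeasurableSpace Ω] {μ : Measure Ω} {E : Subalgebra ℂ (Ω →ₘ[μ] ℂ)}

/-- The constant real class. -/
def constR (μ : Measure Ω) (c : ℝ) : Ω →ₘ[μ] ℝ := AEEqFun.const Ω c

lemma coeFn_constR (c : ℝ) : ∀ᵐ ω ∂μ, constR μ c ω = c := AEEqFun.coeFn_const Ω c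

lemma toComplex_constR_mem (c : ℝ) : toComplex (constR μ c) ∈ E := by
  have h : toComplex (constR μ c) = (((c : ℂ) • 1 : E) : Ω →ₘ[μ] ℂ) := by
    refine AEEqFun.ext ?_
    filter_upwards [coeFn_toComplex (constR μ c), coeFn_constR (μ := μ) c,
      rep_smul_one (E := E) (c : ℂ)] with ω h1 h2 h3
    rw [h1, h2]
    exact h3.symm
  rw [h]
  exact Subtype.property _

lemma isGLB_zero_of_ae {D : Set (Ω →ₘ[μ] ℝ)} (h0 : ∀ d ∈ D, 0 ≤ d) {s : ℕ → Ω →ₘ[μ] ℝ}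
    (hs : ∀ n, s n ∈ D) (h : ∀ᵐ ω ∂μ, Tendsto (fun n => s n ω) atTop (nhds 0)) : IsGLB D 0 := by
  refine ⟨h0, fun c hc => ?_⟩
  rw [← AEEqFun.coeFn_le]
  have h1 : ∀ᵐ ω ∂μ, ∀ n, c ω ≤ s n ω :=
    ae_all_iff.2 fun n => AEEqFun.coeFn_le.2 (hc (hs n))
  filter_upwards [h, h1, AEEqFun.coeFn_zero (α := Ω) (β := ℝ) (μ := μ)] with ω h2 h3 h4
  rw [h4]
  exact ge_of_tendsto' h2 h3

lemma isGLB_range_constR : IsGLB (constR μ '' Set.Ioi (0 : ℝ)) 0 := by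
  refine isGLB_zero_of_ae ?_ (s := fun n => constR μ (1 / ((n : ℝ) + 1)))
    (fun n => ⟨_, Set.mem_Ioi.2 Nat.one_div_pos_of_nat, rfl⟩) ?_
  · rintro _ ⟨c, hc, rfl⟩
    rw [← AEEqFun.coeFn_le]
    filter_upwards [coeFn_constR (μ := μ) c, AEEqFun.coeFn_zero (α := Ω) (β := ℝ) (μ := μ)]
      with ω h1 h2
    rw [h1, h2]
    exact le_of_lt hc
  · have h : ∀ᵐ ω ∂μ, ∀ n : ℕ, constR μ (1 / ((n : ℝ) + 1)) ω = 1 / ((n : ℝ) + 1) :=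
      ae_all_iff.2 fun n => coeFn_constR _
    filter_upwards [h] with ω h1
    simp_rw [h1]
    exact tendsto_one_div_add_atTop_nhds_zero_nat

lemma directedOn_constR (S : Set ℝ) : DirectedOn (fun c d => d ≤ c) (constR μ '' S) := by
  have h : ∀ {b c : ℝ}, b ≤ c → constR μ b ≤ constR μ c := fun {b c} hbc => by
    rw [← AEEqFun.coeFn_le]
    filter_upwards [coeFn_constR (μ := μ) b, coeFn_constR (μ := μ) c] with ω h1 h2
    rw [h1, h2]
    exact hbc
  rintro _ ⟨b, hb, rfl⟩ _ ⟨c, hc, rfl⟩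
  rcases le_total b c with hbc | hbc
  · exact ⟨_, ⟨b, hb, rfl⟩, le_rfl, h hbc⟩
  · exact ⟨_, ⟨c, hc, rfl⟩, h hbc, le_rfl⟩

/-- Uniform convergence to `0` implies order convergence to `0`. -/
lemma oTendstoZero_of_forall_eventually_le {ι : Type*} {f : ι → Ω →ₘ[μ] ℝ} {l : Filter ι}
    (h : ∀ ε : ℝ, 0 < ε → ∀ᶠ i in l, f i ≤ constR μ ε) : OTendstoZero E f l := by
  refine ⟨constR μ '' Set.Ioi (0 : ℝ), ⟨_, 1, Set.mem_Ioi.2 one_pos, rfl⟩, directedOn_constR _, ?_,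
    isGLB_range_constR, ?_⟩
  · rintro _ ⟨c, _, rfl⟩
    exact toComplex_constR_mem c
  · rintro _ ⟨c, hc, rfl⟩
    exact h c hc

variable {U : Type*} [Ring U] [Algebra ℂ U] [Module E U] [IsScalarTower ℂ E U]
  [IsScalarTower E U U] [SMulCommClass E U U] {N : U → Ω →ₘ[μ] ℝ}
  {hN : IsUnitalBanachKantorovichAlgebra E N} {p : E} {hp : IsIdempotentElem p}

/-- The triangle inequality gives `N (v - u) - ε ≤ d` for each `d ∈ D`, and the infimum of `D` is 0.
No sequence is extracted from the net. -/
lemma OTendstoZero.ae_le {U : Type*} [AddCommGroup U] [Module ℂ U] [Module E U]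
    {N : U → Ω →ₘ[μ] ℝ} {l : Filter U} [l.NeBot] {u v : U}
    (h : OTendstoZero E (fun w : U => N (w - u)) l) {ε : ℝ} (hN : IsLatticeNorm E N)
    (hv : ∀ᶠ w in l, ∀ᵐ ω ∂μ, N (v - w) ω ≤ ε) : ∀ᵐ ω ∂μ, N (v - u) ω ≤ ε := by
  obtain ⟨D, -, -, -, hD, hl⟩ := h
  have key : N (v - u) - constR μ ε ≤ 0 := hD.2 fun d hd => by
    obtain ⟨w, h1, h2⟩ := (hv.and (hl d hd)).exists
    rw [← AEEqFun.coeFn_le]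
    filter_upwards [h1, AEEqFun.coeFn_le.2 h2, AEEqFun.coeFn_sub (N (v - u)) (constR μ ε),
      coeFn_constR (μ := μ) ε, hN.ae_add_le (v - w) (w - u)] with ω h3 h4 h5 h6 h7
    rw [h5, Pi.sub_apply, h6]
    rw [sub_add_sub_cancel] at h7
    linarith
  filter_upwards [AEEqFun.coeFn_le.2 key, AEEqFun.coeFn_sub (N (v - u)) (constR μ ε),
      coeFn_constR (μ := μ) ε, AEEqFun.coeFn_zero (α := Ω) (β := ℝ) (μ := μ)] with ω h1 h2 h3 h4
  rw [h2, Pi.sub_apply, h3, h4] at h1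
  exact sub_nonpos.1 h1

instance : CompleteSpace (BddCorner hN hp) := by
  refine Metric.complete_of_cauchySeq_tendsto fun u hu => ?_
  have hle : ∀ ε : ℝ, 0 < ε → ∃ n₀, ∀ m ≥ n₀, ∀ n ≥ n₀,
      ∀ᵐ ω ∂μ, N ((u m).val - (u n).val) ω ≤ ε := fun ε hε => by
    obtain ⟨n₀, h⟩ := Metric.cauchySeq_iff.1 hu ε hε
    refine ⟨n₀, fun m hm n hn => ?_⟩
    filter_upwards [(u m - u n).ae_le_norm] with ω h1
    have h2 := h m hm n hn
    rw [dist_eq_norm] at h2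
    exact h1.trans h2.le
  obtain ⟨v, hv⟩ := hN.complete (map (fun n => (u n).val) atTop) inferInstance (by
    refine oTendstoZero_of_forall_eventually_le fun ε hε => ?_
    obtain ⟨n₀, h⟩ := hle ε hε
    rw [prod_map_map_eq, eventually_map]
    filter_upwards [prod_mem_prod (eventually_ge_atTop n₀) (eventually_ge_atTop n₀)] with q hq
    rw [← AEEqFun.coeFn_le]
    filter_upwards [h q.1 hq.1 q.2 hq.2, coeFn_constR (μ := μ) ε] with ω h1 h2
    rw [h2]
    exact h1)
  -- The limit `v` given by `(bo)`-completeness need not visibly lie in the corner. Multiplication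
  -- by `p` puts it there without increasing the distances.
  have hlim : ∀ ε : ℝ, 0 < ε → ∃ n₀, ∀ m ≥ n₀, ∀ᵐ ω ∂μ, N ((u m).val - p • v) ω ≤ ε :=
    fun ε hε => by
    obtain ⟨n₀, h⟩ := hle ε hε
    refine ⟨n₀, fun m hm => ?_⟩
    have h1 := hv.ae_le (v := (u m).val) (ε := ε) hN.toIsLatticeNorm
      (by rw [eventually_map]; exact (eventually_ge_atTop n₀).mono fun n hn => h m hm n hn)
    filter_upwards [h1, hN.ae_smul p ((u m).val - v), BddCorner.norm_rep_idem_le hp,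
      hN.ae_nonneg ((u m).val - v)] with ω h2 h3 h4 h5
    rw [smul_sub, BddCorner.smul_val] at h3
    rw [h3]
    nlinarith
  obtain ⟨n₁, hn₁⟩ := hlim 1 one_pos
  obtain ⟨C, hC⟩ := (u n₁).exists_bound
  obtain ⟨w, hw⟩ := BddCorner.exists_val_eq (hN := hN) (hp := hp) (u := p • v)
    (idem_smul_smul hp v) (C := C + 1) (by
      filter_upwards [hC, hn₁ n₁ le_rfl, hN.ae_sub_le (u n₁).val ((u n₁).val - p • v)]
        with ω h1 h2 h3
      rw [sub_sub_cancel] at h3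
      linarith)
  refine ⟨w, Metric.tendsto_atTop.2 fun ε hε => ?_⟩
  obtain ⟨n₀, h⟩ := hlim (ε / 2) (half_pos hε)
  refine ⟨n₀, fun n hn => ?_⟩
  rw [dist_eq_norm]
  refine (BddCorner.norm_le_of_ae (half_pos hε).le ?_).trans_lt (half_lt_self hε)
  rw [BddCorner.val_sub, hw]
  exact h n hn

end Complete

/-! ### Inverses in corners and their stability -/

section Inverse

variable {Ω : Type*} [MeasurableSpace Ω] {μ : Measure Ω} {E : Subalgebra ℂ (Ω →ₘ[μ] ℂ)}
  {U : Type*} [Ring U] [Algebra ℂ U] [Module E U] [IsScalarTower ℂ E U]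
  [IsScalarTower E U U] [SMulCommClass E U U] {N : U → Ω →ₘ[μ] ℝ}

/-- `y` is the inverse of `p z` in `pU`. -/
structure InvOn (p : E) (z y : U) : Prop where
  smul : p • y = y
  mul_right : z * y = p • (1 : U)
  mul_left : y * z = p • (1 : U)

omit [Algebra ℂ U] [IsScalarTower ℂ E U] in
lemma isInvIn_iff {p : E} (hp : IsIdempotentElem p) {z : U} :
    IsInvIn p (p • z) ↔ ∃ y, InvOn p z y := by
  constructor
  · rintro ⟨-, y, ⟨w, rfl⟩, h1, h2⟩
    refine ⟨p • w, idem_smul_smul hp w, ?_, ?_⟩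
    · rw [← h1, smul_mul_assoc, mul_smul_comm, idem_smul_smul hp]
    · rw [← h2, mul_smul_comm, smul_mul_assoc, idem_smul_smul hp]
  · rintro ⟨y, h1, h2, h3⟩
    refine ⟨⟨z, rfl⟩, y, ⟨y, h1⟩, ?_, ?_⟩
    · rw [smul_mul_assoc, h2, idem_smul_smul hp]
    · rw [mul_smul_comm, h3, idem_smul_smul hp]

omit [Algebra ℂ U] [IsScalarTower ℂ E U] in
lemma InvOn.mono {p q : E} (hq : IsIdempotentElem q) (h : q * p = q) {z y : U}
    (hy : InvOn p z y) : InvOn q z (q • y) where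
  smul := idem_smul_smul hq y
  mul_right := by rw [mul_smul_comm, hy.mul_right, smul_smul, h]
  mul_left := by rw [smul_mul_assoc, hy.mul_left, smul_smul, h]

omit [Algebra ℂ U] [IsScalarTower ℂ E U] in
lemma InvOn.of_left_right {p : E} {z y y' : U} (h1 : p • y = y) (h1' : p • y' = y')
    (h2 : z * y = p • (1 : U)) (h3 : y' * z = p • (1 : U)) : InvOn p z y := by
  have h : y' = y := by
    calc y' = y' * (p • (1 : U)) := by rw [mul_smul_comm, mul_one, h1']
      _ = y' * z * y := by rw [← h2, mul_assoc]
      _ = y := by rw [h3, smul_mul_assoc, one_mul, h1]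
  exact ⟨h1, h2, h ▸ h3⟩

/-- The Neumann series in `pU`. -/
lemma exists_invOn_one_sub (hN : IsUnitalBanachKantorovichAlgebra E N) {p : E}
    (hp : IsIdempotentElem p) {u : U} (hu : p • u = u) {q : ℝ} (hq0 : 0 ≤ q) (hq : q < 1)
    (h : ∀ᵐ ω ∂μ, N u ω ≤ q) : ∃ v, InvOn p (1 - u) v := by
  obtain ⟨w, rfl⟩ := BddCorner.exists_val_eq (hN := hN) (hp := hp) hu h
  have hw : ‖w‖ < 1 := (BddCorner.norm_le_of_ae hq0 h).trans_lt hq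
  let i := Units.oneSub w hw
  have h1 : (1 - w) * (↑i⁻¹ : BddCorner hN hp) = 1 := i.mul_inv
  have h2 : (↑i⁻¹ : BddCorner hN hp) * (1 - w) = 1 := i.inv_mul
  generalize (↑i⁻¹ : BddCorner hN hp) = v at h1 h2
  have h3 := congrArg BddCorner.val h1
  have h4 := congrArg BddCorner.val h2
  simp only [BddCorner.val_mul, BddCorner.val_sub, BddCorner.val_one] at h3 h4
  refine ⟨v.val, v.smul_val, ?_, ?_⟩
  · rw [← h3, sub_mul, sub_mul, smul_mul_assoc, one_mul, v.smul_val]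
  · rw [← h4, mul_sub, mul_sub, mul_smul_comm, mul_one, v.smul_val]

/-- The spectrum is nonempty in the Banach algebra of bounded elements of `pU`. -/
lemma exists_forall_not_invOn (hN : IsUnitalBanachKantorovichAlgebra E N) {p : E}
    (hp : IsIdempotentElem p) (h0 : p ≠ 0) {x : U} {R : ℝ} (hR : 0 ≤ R)
    (h : ∀ᵐ ω ∂μ, N (p • x) ω ≤ R) :
    ∃ c : ℂ, ‖c‖ ≤ R ∧ ∀ y, InvOn p ((c • 1 : E) • (1 : U) - x) y →
      ∀ M : ℝ, ¬ ∀ᵐ ω ∂μ, N y ω ≤ M := by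
  obtain ⟨w, hw⟩ := BddCorner.exists_val_eq (hN := hN) (hp := hp) (idem_smul_smul hp x) h
  have := BddCorner.nontrivial (hN := hN) (hp := hp) h0
  obtain ⟨c, hc⟩ := spectrum.nonempty w
  refine ⟨c, ?_, fun y hy M hM => hc ?_⟩
  · have h1 := spectrum.norm_le_norm_mul_of_mem hc
    have h2 : ‖w‖ ≤ R := BddCorner.norm_le_of_ae hR (by rwa [hw])
    have h3 := BddCorner.norm_one_le (hN := hN) (hp := hp)
    have h4 := norm_nonneg w
    nlinarith
  · obtain ⟨v, rfl⟩ := BddCorner.exists_val_eq (hN := hN) (hp := hp) hy.smul hM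
    have hval : (algebraMap ℂ (BddCorner hN hp) c - w).val =
        p • ((c • 1 : E) • (1 : U) - x) := by
      rw [Algebra.algebraMap_eq_smul_one, BddCorner.val_sub, hw, BddCorner.val_smul,
        BddCorner.val_one, smul_sub, smul_smul, mul_comm, ← smul_smul, smul_assoc c (1 : E),
        one_smul]
    refine ⟨⟨_, v, BddCorner.val_injective ?_, BddCorner.val_injective ?_⟩, rfl⟩
    · rw [BddCorner.val_mul, hval, smul_mul_assoc, hy.mul_right, idem_smul_smul hp,
        BddCorner.val_one]
    · rw [BddCorner.val_mul, hval, mul_smul_comm, hy.mul_left, idem_smul_smul hp,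
        BddCorner.val_one]

/-- Invertibility is stable under small perturbations. -/
lemma InvOn.perturb (hN : IsUnitalBanachKantorovichAlgebra E N) {p q : E}
    (hq : IsIdempotentElem q) (hqp : q * p = q) {a b : E} {x y : U}
    (hy : InvOn p (a • (1 : U) - x) y)
    (h : ∀ᵐ ω ∂μ, rep q ω ≠ 0 → ‖rep b ω - rep a ω‖ * N y ω ≤ 1 / 2) :
    ∃ y', InvOn q (b • (1 : U) - x) y' ∧ ∀ᵐ ω ∂μ, N y' ω ≤ 2 * N y ω := by
  set s : E := a - b with hs
  have hb : b • (1 : U) - x = (a • (1 : U) - x) - s • (1 : U) := by rw [hs, sub_smul]; abel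
  have hrep := BddCorner.norm_rep_idem_le hq
  have hw : ∀ᵐ ω ∂μ, N (q • s • y) ω ≤ 1 / 2 := by
    filter_upwards [hN.ae_smul q (s • y), hN.ae_smul s y, h, hrep, rep_sub a b, hN.ae_nonneg y]
      with ω h1 h2 h3 h4 h5 h6
    rw [h1, h2, h5, norm_sub_rev]
    by_cases h7 : rep q ω = 0
    · rw [h7, norm_zero, zero_mul]; norm_num
    · have h8 := h3 h7
      have h9 : 0 ≤ ‖rep b ω - rep a ω‖ * N y ω := mul_nonneg (norm_nonneg _) h6
      nlinarith [norm_nonneg (rep q ω)]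
  -- Both `(b • 1 - x) * y` and `y * (b • 1 - x)` equal `p • 1 - s • y`. Hence, with `v` the inverse
  -- of `1 - q • s • y` over `q`, the product `y * v` is a right inverse and `v * y` a left inverse.
  obtain ⟨v, hv⟩ := exists_invOn_one_sub hN hq (idem_smul_smul hq (s • y)) (by norm_num)
    (by norm_num) hw
  have hqv := hv.smul
  have hv1 : v = q • (1 : U) + (q • s • y) * v := by rw [← hv.mul_right]; noncomm_ring
  -- From `v = q • 1 + (q • s • y) * v` one gets `N v ≤ 1 + N v / 2`.
  have hvle : ∀ᵐ ω ∂μ, N v ω ≤ 2 := by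
    have h1 := hN.ae_add_le (q • (1 : U)) ((q • s • y) * v)
    rw [← hv1] at h1
    filter_upwards [h1, hN.ae_mul_le (q • s • y) v, hN.ae_smul_one q, hrep, hw,
      hN.ae_nonneg v] with ω h2 h3 h4 h5 h6 h7
    nlinarith
  have e1 : (b • (1 : U) - x) * (y * v) = q • (1 : U) := by
    have h1 : (b • (1 : U) - x) * y = p • (1 : U) - s • y := by
      rw [hb, sub_mul, hy.mul_right, smul_mul_assoc, one_mul]
    rw [← mul_assoc, h1, ← hv.mul_right]
    nth_rewrite 1 [← hqv]
    rw [mul_smul_comm, ← smul_mul_assoc, smul_sub, smul_smul, hqp, sub_mul, sub_mul,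
      smul_mul_assoc, one_mul, hqv]
  have e2 : (v * y) * (b • (1 : U) - x) = q • (1 : U) := by
    have h1 : y * (b • (1 : U) - x) = p • (1 : U) - s • y := by
      rw [hb, mul_sub, hy.mul_left, mul_smul_comm, mul_one]
    rw [mul_assoc, h1, ← hv.mul_left]
    nth_rewrite 1 [← hqv]
    rw [smul_mul_assoc, ← mul_smul_comm, smul_sub, smul_smul, hqp, mul_sub, mul_sub,
      mul_smul_comm, mul_one, hqv]
  refine ⟨y * v, InvOn.of_left_right (y' := v * y) ?_ ?_ e1 e2, ?_⟩
  · rw [← mul_smul_comm, hqv]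
  · rw [← smul_mul_assoc, hqv]
  · filter_upwards [hN.ae_mul_le y v, hvle, hN.ae_nonneg y] with ω h1 h2 h3
    nlinarith

end Inverse

/-! ### Measurable selection, essential unions and finite covers -/

section Selection

variable {Ω : Type*} [MeasurableSpace Ω]

/-- A measurable choice of an index. -/
lemma exists_measurable_index {G : ℕ → Set Ω} (hG : ∀ j, MeasurableSet (G j)) :
    ∃ k : Ω → ℕ, Measurable k ∧ ∀ ω, (∃ j, ω ∈ G j) → ω ∈ G (k ω) := by
  classical
  -- The second alternative makes the search for the least index terminate at every point.
  have hp : ∀ ω, ∃ j, ω ∈ G j ∨ ∀ i, ω ∉ G i := fun ω => by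
    by_cases h : ∃ j, ω ∈ G j
    · exact h.imp fun _ => Or.inl
    · push Not at h
      exact ⟨0, Or.inr h⟩
  refine ⟨fun ω => Nat.find (hp ω), measurable_find hp fun j => ?_, fun ω ⟨j, hj⟩ => ?_⟩
  · have h : {ω | ω ∈ G j ∨ ∀ i, ω ∉ G i} = G j ∪ ⋂ i, (G i)ᶜ := by
      ext ω; simp
    rw [h]
    exact (hG j).union (MeasurableSet.iInter fun i => (hG i).compl)
  · exact (Nat.find_spec (hp ω)).resolve_right fun h => h j hj

/-- The essential union of a family of measurable sets is attained by a sequence. -/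
lemma exists_essential_union (μ : Measure Ω) [IsFiniteMeasure μ] (P : Set Ω → Prop)
    (h0 : P ∅) (hP : ∀ A, P A → MeasurableSet A) :
    ∃ S : ℕ → Set Ω, (∀ n, P (S n)) ∧ ∀ A, P A → μ (A \ ⋃ n, S n) = 0 := by
  -- A countable union of maximal measure is sought: adjoining a further `A` cannot increase its
  -- measure, and finiteness of `μ` allows cancellation.
  let V : Set ENNReal := {r | ∃ S : ℕ → Set Ω, (∀ n, P (S n)) ∧ r = μ (⋃ n, S n)}
  have hV : V.Nonempty := ⟨_, fun _ => ∅, fun _ => h0, rfl⟩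
  obtain ⟨r, -, hr, hrV⟩ := exists_seq_tendsto_sSup hV (OrderTop.bddAbove V)
  choose T hT hrT using hrV
  refine ⟨fun n => T n.unpair.1 n.unpair.2, fun n => hT _ _, fun A hA => ?_⟩
  set G := ⋃ n : ℕ, T n.unpair.1 n.unpair.2 with hG
  have hGm : MeasurableSet G := MeasurableSet.iUnion fun n => hP _ (hT _ _)
  have h1 : sSup V ≤ μ G := by
    refine le_of_tendsto' hr fun n => ?_
    rw [hrT]
    refine measure_mono (Set.iUnion_subset fun m => ?_)
    refine Set.subset_iUnion_of_subset (Nat.pair n m) ?_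
    rw [Nat.unpair_pair]
  have h2 : μ (G ∪ A) ≤ sSup V := by
    refine le_sSup ⟨fun n => Nat.casesOn n A fun m => T m.unpair.1 m.unpair.2, ?_, ?_⟩
    · rintro (_ | n)
      · exact hA
      · exact hT _ _
    · congr 1
      ext ω
      simp only [Set.mem_union, Set.mem_iUnion, hG]
      constructor
      · rintro (⟨n, h⟩ | h)
        · exact ⟨n + 1, h⟩
        · exact ⟨0, h⟩
      · rintro ⟨_ | n, h⟩
        · exact Or.inr h
        · exact Or.inl ⟨n, h⟩
  have h3 : μ G + μ (A \ G) = μ (G ∪ A) := by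
    rw [← measure_union Set.disjoint_sdiff_right ((hP A hA).diff hGm), Set.union_sdiff_self]
  have h4 : μ G + μ (A \ G) ≤ μ G + 0 := by
    rw [h3, add_zero]
    exact h2.trans h1
  exact le_antisymm ((ENNReal.add_le_add_iff_left (measure_ne_top μ G)).1 h4) zero_le

/-- Compactness gives a finite cover; a ball containing a point of the given one has its centre
within `r + ε` of `c`, so the others are discarded. This distance bound makes the centres along a
branch converge. -/
lemma exists_finset_closedBall_subset {d : ℕ → ℂ} (hd : DenseRange d) (c : ℂ) (r : ℝ) {ε : ℝ}
    (hε : 0 < ε) : ∃ t : Finset ℕ, (Metric.closedBall c r ⊆ ⋃ j ∈ t, Metric.closedBall (d j) ε) ∧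
      ∀ j ∈ t, dist c (d j) ≤ r + ε := by
  classical
  obtain ⟨t, ht⟩ := (isCompact_closedBall c r).elim_finite_subcover
    (fun j => Metric.ball (d j) ε) (fun j => Metric.isOpen_ball) (fun z _ => by
      obtain ⟨j, hj⟩ := hd.exists_dist_lt z hε
      exact Set.mem_iUnion.2 ⟨j, hj⟩)
  refine ⟨t.filter fun j => dist c (d j) ≤ r + ε, fun z hz => ?_,
    fun j hj => (Finset.mem_filter.1 hj).2⟩
  obtain ⟨j, hj, hzj⟩ := Set.mem_iUnion₂.1 (ht hz)
  refine Set.mem_iUnion₂.2 ⟨j, Finset.mem_filter.2 ⟨hj, ?_⟩, Metric.ball_subset_closedBall hzj⟩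
  have h1 := Metric.mem_ball.1 hzj
  have h2 := Metric.mem_closedBall'.1 hz
  exact (dist_triangle c z (d j)).trans (add_le_add h2 h1.le)

end Selection

/-! ### Free discs and nonemptiness of the mixed spectrum -/

section Nonempty

variable {Ω : Type*} [MeasurableSpace Ω] {μ : Measure Ω} {E : Subalgebra ℂ (Ω →ₘ[μ] ℂ)}
  {U : Type*} [Ring U] [Algebra ℂ U] [Module E U] [IsScalarTower ℂ E U]
  [IsScalarTower E U U] [SMulCommClass E U U] {N : U → Ω →ₘ[μ] ℝ}

/-- The resolvent of `x` is defined and uniformly bounded on `Q`, over `A`. -/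
def IsFree (hE : IsFaithfulSolid E) (N : U → Ω →ₘ[μ] ℝ) (x : U) (Q : Set ℂ) (A : Set Ω) : Prop :=
  ∃ (hA : MeasurableSet A) (M : ℝ), ∀ c ∈ Q, ∃ y,
    InvOn (chi hE hA) ((c • 1 : E) • (1 : U) - x) y ∧ ∀ᵐ ω ∂μ, N y ω ≤ M

variable {hE : IsFaithfulSolid E} {x : U}

omit [IsScalarTower ℂ E U] [IsScalarTower E U U] [SMulCommClass E U U] in
lemma ae_chi_smul (hN : IsLatticeNorm E N) {A : Set Ω} (hA : MeasurableSet A) (u : U) :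
    ∀ᵐ ω ∂μ, N (chi hE hA • u) ω = A.indicator (N u) ω := by
  filter_upwards [hN.ae_smul (chi hE hA) u, rep_chi hE hA] with ω h1 h2
  rw [h1, h2]
  by_cases h : ω ∈ A <;> simp [h]

omit [IsScalarTower ℂ E U] in
lemma IsFree.mono (hN : IsLatticeNorm E N) {Q : Set ℂ} {A B : Set Ω} (h : IsFree hE N x Q A)
    (hB : MeasurableSet B) (hBA : B ⊆ A) : IsFree hE N x Q B := by
  obtain ⟨hA, M, hM⟩ := h
  refine ⟨hB, M, fun c hc => ?_⟩
  obtain ⟨y, hy, hyM⟩ := hM c hc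
  refine ⟨_, hy.mono (isIdempotentElem_chi hE hB) (chi_mul_chi hE hA hB hBA), ?_⟩
  filter_upwards [hyM, ae_chi_smul (hE := hE) hN hB y, hN.ae_nonneg y] with ω h1 h2 h3
  rw [h2]
  by_cases h : ω ∈ B
  · rwa [Set.indicator_of_mem h]
  · rw [Set.indicator_of_notMem h]
    exact h3.trans h1

omit [IsScalarTower ℂ E U] [IsScalarTower E U U] [SMulCommClass E U U] in
lemma isFree_empty (hN : IsLatticeNorm E N) (Q : Set ℂ) : IsFree hE N x Q ∅ := by
  have h : chi hE MeasurableSet.empty = 0 := by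
    refine rep_ext ?_
    filter_upwards [rep_chi hE MeasurableSet.empty, rep_zero (E := E)] with ω h1 h2
    rw [h1, h2, Set.indicator_empty]
  refine ⟨MeasurableSet.empty, 0, fun c _ => ⟨0, ⟨smul_zero _, ?_, ?_⟩, ?_⟩⟩
  · rw [h, mul_zero, zero_smul]
  · rw [h, zero_mul, zero_smul]
  · exact hN.ae_zero.mono fun _ h => h.le

omit [Algebra ℂ U] [IsScalarTower ℂ E U] [IsScalarTower E U U] [SMulCommClass E U U] in
lemma IsFree.union {Q Q' : Set ℂ} {A : Set Ω} (h : IsFree hE N x Q A)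
    (h' : IsFree hE N x Q' A) : IsFree hE N x (Q ∪ Q') A := by
  obtain ⟨hA, M, hM⟩ := h
  obtain ⟨_, M', hM'⟩ := h'
  refine ⟨hA, max M M', fun c hc => ?_⟩
  rcases hc with hc | hc
  · obtain ⟨y, hy, hle⟩ := hM c hc
    exact ⟨y, hy, hle.mono fun ω h => h.trans (le_max_left _ _)⟩
  · obtain ⟨y, hy, hle⟩ := hM' c hc
    exact ⟨y, hy, hle.mono fun ω h => h.trans (le_max_right _ _)⟩

omit [IsScalarTower ℂ E U] in
-- For each index of `t` the set is cut down to a non-null part inside a single `S i m`. Only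
-- finitely many cuts are made, so the result stays non-null and the bounds have a maximum.
lemma exists_isFree_biUnion (hN : IsLatticeNorm E N) {Q : ℕ → Set ℂ} {S : ℕ → ℕ → Set Ω}
    (hS : ∀ j m, IsFree hE N x (Q j) (S j m)) (t : Finset ℕ) {A : Set Ω} (hA : MeasurableSet A)
    (h0 : μ A ≠ 0) (hAS : ∀ j ∈ t, A ⊆ ⋃ m, S j m) :
    ∃ B ⊆ A, μ B ≠ 0 ∧ IsFree hE N x (⋃ j ∈ t, Q j) B := by
  induction t using Finset.induction_on generalizing A with
  | empty => exact ⟨A, subset_rfl, h0, hA, 0, fun c hc => by simp at hc⟩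
  | insert i t hi ih =>
    obtain ⟨B, hBA, hB0, hB⟩ := ih hA h0 fun j hj => hAS j (Finset.mem_insert_of_mem hj)
    obtain ⟨m, hm⟩ := exists_measure_inter_ne_zero hB0 (S := S i) (.of_forall fun ω hω =>
      Set.mem_iUnion.1 (hAS i (Finset.mem_insert_self i t) (hBA hω)))
    have hmeas : MeasurableSet (B ∩ S i m) := hB.1.inter (hS i m).1
    refine ⟨B ∩ S i m, Set.inter_subset_left.trans hBA, hm, ?_⟩
    rw [Finset.set_biUnion_insert]
    exact ((hS i m).mono hN hmeas Set.inter_subset_right).union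
      (hB.mono hN hmeas Set.inter_subset_left)

omit [IsScalarTower ℂ E U] in
lemma ae_exists_notMem (hN : IsLatticeNorm E N) {Q : ℕ → Set ℂ} {S : ℕ → ℕ → Set Ω}
    (hS : ∀ j m, IsFree hE N x (Q j) (S j m)) (t : Finset ℕ) {A : Set Ω} (hA : MeasurableSet A)
    {Q' : Set ℂ} (hQ' : Q' ⊆ ⋃ j ∈ t, Q j)
    (h : ∀ B ⊆ A, μ B ≠ 0 → ¬ IsFree hE N x Q' B) :
    ∀ᵐ ω ∂μ, ω ∈ A → ∃ j ∈ t, ω ∉ ⋃ m, S j m := by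
  have hm : MeasurableSet (A ∩ ⋂ j ∈ t, ⋃ m, S j m) :=
    hA.inter (t.measurableSet_biInter fun j _ => MeasurableSet.iUnion fun m => (hS j m).1)
  have h0 : μ (A ∩ ⋂ j ∈ t, ⋃ m, S j m) = 0 := by
    by_contra h0
    obtain ⟨B, hB, hB0, hfree⟩ := exists_isFree_biUnion hN hS t hm h0
      fun j hj => Set.inter_subset_right.trans (Set.biInter_subset_of_mem hj)
    obtain ⟨hBm, M, hM⟩ := hfree
    exact h B (hB.trans Set.inter_subset_left) hB0 ⟨hBm, M, fun c hc => hM c (hQ' hc)⟩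
  filter_upwards [measure_eq_zero_iff_ae_notMem.1 h0] with ω h1 h2
  by_contra! hc
  exact h1 ⟨h2, Set.mem_iInter₂.2 hc⟩

omit [IsScalarTower ℂ E U] [IsScalarTower E U U] [SMulCommClass E U U] in
lemma IsFaithfulSolid.exists_rep_of_le_norm (hE : IsFaithfulSolid E) (hN : IsLatticeNorm E N)
    (u : U) (C : ℝ) {f : Ω → ℂ} (hf : AEMeasurable f μ)
    (h : ∀ᵐ ω ∂μ, ‖f ω‖ ≤ N u ω + C) : ∃ a : E, ∀ᵐ ω ∂μ, rep a ω = f ω := by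
  refine hE.exists_rep hf ((⟨_, hN.mem u⟩ : E) + (C : ℂ) • 1) ?_
  have h1 : ∀ᵐ ω ∂μ, rep (⟨_, hN.mem u⟩ : E) ω = (N u ω : ℂ) := coeFn_toComplex (N u)
  filter_upwards [h, h1, rep_add (⟨_, hN.mem u⟩ : E) ((C : ℂ) • 1),
    rep_smul_one (E := E) (C : ℂ)] with ω h2 h3 h4 h5
  rw [h4, h3, h5, ← Complex.ofReal_add, Complex.norm_real]
  exact h2.trans (le_abs_self _)

/-- The tree of balls that are not free has a measurable branch. -/
lemma exists_measurable_branch [IsFiniteMeasure μ] (hE : IsFaithfulSolid E)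
    (hN : IsUnitalBanachKantorovichAlgebra E N) (x : U) {d : ℕ → ℂ} (hd : DenseRange d) :
    ∃ k : ℕ → Ω → ℕ, (∀ n, Measurable (k n)) ∧
      (∀ᵐ ω ∂μ, dist 0 (d (k 0 ω)) ≤ N x ω + 2) ∧
      (∀ᵐ ω ∂μ, ∀ n, dist (d (k n ω)) (d (k (n + 1) ω)) ≤ 2 * (1 / 2 : ℝ) ^ n) ∧
      ∀ n j B, IsFree hE N x (Metric.closedBall (d j) ((1 / 2 : ℝ) ^ n)) B →
        ∀ᵐ ω ∂μ, ω ∈ B → k n ω ≠ j := by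
  -- Outside the essential union `⋃ m, S n j m`, the disc number `j` of level `n` is free over no
  -- non-null set.
  have hS : ∀ n j, ∃ S : ℕ → Set Ω,
      (∀ m, IsFree hE N x (Metric.closedBall (d j) ((1 / 2 : ℝ) ^ n)) (S m)) ∧
      ∀ A, IsFree hE N x (Metric.closedBall (d j) ((1 / 2 : ℝ) ^ n)) A → μ (A \ ⋃ m, S m) = 0 :=
    fun n j => exists_essential_union μ _ (isFree_empty hN.toIsLatticeNorm _) fun A hA => hA.1
  choose S hS hmax using hS
  have hF : ∀ n j, MeasurableSet (⋃ m, S n j m) :=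
    fun n j => MeasurableSet.iUnion fun m => (hS n j m).1
  have hNx : Measurable (N x : Ω → ℝ) := AEEqFun.measurable _
  have hroot : ∀ᵐ ω ∂μ, ∀ (R : ℕ) (t : Finset ℕ),
      Metric.closedBall 0 (R : ℝ) ⊆ ⋃ j ∈ t, Metric.closedBall (d j) ((1 / 2 : ℝ) ^ 0) →
      N x ω ≤ R → ∃ j ∈ t, ω ∉ ⋃ m, S 0 j m := by
    refine ae_all_iff.2 fun R => ae_all_iff.2 fun t => ?_
    by_cases ht : Metric.closedBall 0 (R : ℝ) ⊆ ⋃ j ∈ t, Metric.closedBall (d j) ((1 / 2 : ℝ) ^ 0)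
    swap
    · exact .of_forall fun ω h => absurd h ht
    -- Over a non-null `B` with `N x ≤ R`, freeness of the disc of radius `R` would give bounded
    -- inverses at every spectral value of the restriction of `x`.
    have h1 := ae_exists_notMem hN.toIsLatticeNorm (hS 0) t (A := {ω | N x ω ≤ R})
      (measurableSet_le hNx measurable_const) ht fun B hB hB0 hfree => by
        obtain ⟨hBm, M, hM⟩ := hfree
        obtain ⟨c, hc, hinv⟩ := exists_forall_not_invOn hN (isIdempotentElem_chi hE hBm)
          (chi_ne_zero hE hBm hB0) (x := x) (R := R) (Nat.cast_nonneg R) (by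
            filter_upwards [ae_chi_smul (hE := hE) hN.toIsLatticeNorm hBm x] with ω h1
            rw [h1]
            by_cases h : ω ∈ B
            · rw [Set.indicator_of_mem h]
              exact hB h
            · rw [Set.indicator_of_notMem h]
              exact Nat.cast_nonneg R)
        obtain ⟨y, hy, hyM⟩ := hM c (by simpa using hc)
        exact hinv y hy M hyM
    filter_upwards [h1] with ω h2 _ h3
    exact h2 h3
  have hstep : ∀ᵐ ω ∂μ, ∀ (n i : ℕ) (t : Finset ℕ), Metric.closedBall (d i) ((1 / 2 : ℝ) ^ n) ⊆
      ⋃ j ∈ t, Metric.closedBall (d j) ((1 / 2 : ℝ) ^ (n + 1)) →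
      ω ∉ ⋃ m, S n i m → ∃ j ∈ t, ω ∉ ⋃ m, S (n + 1) j m := by
    refine ae_all_iff.2 fun n => ae_all_iff.2 fun i => ae_all_iff.2 fun t => ?_
    by_cases ht : Metric.closedBall (d i) ((1 / 2 : ℝ) ^ n) ⊆
      ⋃ j ∈ t, Metric.closedBall (d j) ((1 / 2 : ℝ) ^ (n + 1))
    swap
    · exact .of_forall fun ω h => absurd h ht
    have h1 := ae_exists_notMem hN.toIsLatticeNorm (hS (n + 1)) t (hF n i).compl ht
      fun B hB hB0 hfree => hB0 (by
        have h2 := hmax n i B hfree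
        rwa [Set.sdiff_eq, Set.inter_eq_left.2 hB] at h2)
    filter_upwards [h1] with ω h2 _ h3
    exact h2 h3
  obtain ⟨k₀, hk₀m, hk₀⟩ := exists_measurable_index
    (G := fun j => (⋃ m, S 0 j m)ᶜ ∩ {ω | dist 0 (d j) ≤ N x ω + 2})
    fun j => (hF 0 j).compl.inter (measurableSet_le measurable_const (hNx.add_const 2))
  have hnext : ∀ (n : ℕ) (k : {k : Ω → ℕ // Measurable k}), ∃ k' : {k : Ω → ℕ // Measurable k},
      ∀ ω, (∃ j, ω ∉ (⋃ m, S (n + 1) j m) ∧ dist (d (k.1 ω)) (d j) ≤ 2 * (1 / 2 : ℝ) ^ n) →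
        ω ∉ (⋃ m, S (n + 1) (k'.1 ω) m) ∧
          dist (d (k.1 ω)) (d (k'.1 ω)) ≤ 2 * (1 / 2 : ℝ) ^ n := fun n k => by
    have hdk : Measurable fun ω => d (k.1 ω) := (measurable_from_nat (f := d)).comp k.2
    obtain ⟨k', hm, hk'⟩ := exists_measurable_index
      (G := fun j => (⋃ m, S (n + 1) j m)ᶜ ∩ {ω | dist (d (k.1 ω)) (d j) ≤ 2 * (1 / 2 : ℝ) ^ n})
      fun j => (hF (n + 1) j).compl.inter
        (measurableSet_le (hdk.dist measurable_const) measurable_const)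
    exact ⟨⟨k', hm⟩, hk'⟩
  choose next hnext using hnext
  let k : ℕ → {k : Ω → ℕ // Measurable k} := fun n => Nat.rec ⟨k₀, hk₀m⟩ (fun n k => next n k) n
  -- The 2 is one unit for rounding `N x ω` up to an integer and one for the radius of the discs of
  -- level 0.
  have hk : ∀ᵐ ω ∂μ, ω ∉ (⋃ m, S 0 (k₀ ω) m) ∧ dist 0 (d (k₀ ω)) ≤ N x ω + 2 := by
    filter_upwards [hroot, hN.ae_nonneg x] with ω h1 h2
    obtain ⟨t, ht, htd⟩ := exists_finset_closedBall_subset hd 0 (⌈N x ω⌉₊ : ℝ)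
      (ε := (1 / 2 : ℝ) ^ 0) (by norm_num)
    obtain ⟨j, hj, hjS⟩ := h1 _ t ht (Nat.le_ceil _)
    refine hk₀ ω ⟨j, hjS, ?_⟩
    have h3 := htd j hj
    have h4 := Nat.ceil_lt_add_one h2
    rw [pow_zero] at h3
    exact h3.trans (by linarith)
  have hkn : ∀ᵐ ω ∂μ, ∀ n, ω ∉ (⋃ m, S n ((k n).1 ω) m) ∧
      dist (d ((k n).1 ω)) (d ((k (n + 1)).1 ω)) ≤ 2 * (1 / 2 : ℝ) ^ n := by
    filter_upwards [hstep, hk] with ω h1 h2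
    have hkey : ∀ n, ω ∉ (⋃ m, S n ((k n).1 ω) m) → ω ∉ (⋃ m, S (n + 1) ((k (n + 1)).1 ω) m) ∧
        dist (d ((k n).1 ω)) (d ((k (n + 1)).1 ω)) ≤ 2 * (1 / 2 : ℝ) ^ n := fun n hn => by
      obtain ⟨t, ht, htd⟩ := exists_finset_closedBall_subset hd (d ((k n).1 ω))
        ((1 / 2 : ℝ) ^ n) (ε := (1 / 2 : ℝ) ^ (n + 1)) (by positivity)
      obtain ⟨j, hj, hjS⟩ := h1 n _ t ht hn
      refine hnext n (k n) ω ⟨j, hjS, (htd j hj).trans ?_⟩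
      have : (0 : ℝ) < (1 / 2 : ℝ) ^ n := by positivity
      rw [pow_succ]
      linarith
    have hmem : ∀ n, ω ∉ (⋃ m, S n ((k n).1 ω) m) := fun n => by
      induction n with
      | zero => exact h2.1
      | succ n ih => exact (hkey n ih).1
    exact fun n => ⟨hmem n, (hkey n (hmem n)).2⟩
  refine ⟨fun n => (k n).1, fun n => (k n).2, hk.mono fun ω h => h.2,
    hkn.mono fun ω h n => (h n).2, fun n j B hB => ?_⟩
  filter_upwards [hkn, measure_eq_zero_iff_ae_notMem.1 (hmax n j B hB)] with ω h1 h2 h3 h4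
  exact h2 ⟨h3, h4 ▸ (h1 n).1⟩

theorem spm_nonempty [IsFiniteMeasure μ] (hE : IsFaithfulSolid E)
    (hN : IsUnitalBanachKantorovichAlgebra E N) (x : U) : (spm E x).Nonempty := by
  obtain ⟨k, hkm, hk0, hkd, hkfree⟩ :=
    exists_measurable_branch hE hN x (TopologicalSpace.denseRange_denseSeq ℂ)
  set d := TopologicalSpace.denseSeq ℂ
  obtain ⟨f, hfm, hf⟩ := measurable_limit_of_tendsto_metrizable_ae (μ := μ) (L := atTop)
    (f := fun n ω => d (k n ω))
    (fun n => ((measurable_from_nat (f := d)).comp (hkm n)).aemeasurable) (by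
      filter_upwards [hkd] with ω h
      exact cauchySeq_tendsto_of_complete (cauchySeq_of_le_geometric (1 / 2) 2 (by norm_num) h))
  have hdist : ∀ᵐ ω ∂μ, ∀ n, dist (d (k n ω)) (f ω) ≤ 4 * (1 / 2 : ℝ) ^ n := by
    filter_upwards [hkd, hf] with ω h1 h2 n
    refine (dist_le_of_le_geometric_of_tendsto (1 / 2) 2 (by norm_num) h1 h2 n).trans_eq ?_
    ring
  -- Here 6 = 2 + 4: the bound for the first centre plus the geometric tail at level 0. The limit
  -- therefore lies in `E` by solidity.
  obtain ⟨a, ha⟩ := hE.exists_rep_of_le_norm hN.toIsLatticeNorm x 6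
    hfm.aemeasurable (by
      filter_upwards [hdist, hk0] with ω h1 h2
      have h3 := dist_triangle 0 (d (k 0 ω)) (f ω)
      have h4 := h1 0
      rw [dist_zero_left] at h3
      rw [pow_zero] at h4
      linarith)
  refine ⟨a, fun p hp hp0 hinv => ?_⟩
  obtain ⟨y, hy⟩ := (isInvIn_iff hp).1 hinv
  obtain ⟨A, hA, hA0, rfl⟩ := exists_eq_chi hE hp hp0
  obtain ⟨M, hM⟩ := exists_measure_inter_ne_zero hA0 (S := fun M : ℕ => {ω | N y ω ≤ M})
    (.of_forall fun ω _ => exists_nat_ge (N y ω))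
  -- A point of the disc is within `(1 / 2) ^ n` of its centre, which is within `4 * (1 / 2) ^ n` of
  -- the limit; `1 / 2` is the threshold in `InvOn.perturb`.
  obtain ⟨n, hn⟩ : ∃ n : ℕ, 5 * (1 / 2 : ℝ) ^ n * M ≤ 1 / 2 := by
    have h1 : Tendsto (fun n : ℕ => 5 * (1 / 2 : ℝ) ^ n * M) atTop (nhds (5 * 0 * M)) :=
      ((tendsto_pow_atTop_nhds_zero_of_lt_one (by norm_num) (by norm_num)).const_mul 5).mul_const _
    rw [mul_zero, zero_mul] at h1
    exact ((h1.eventually_lt_const (by norm_num : (0 : ℝ) < 1 / 2)).exists).imp fun n h => h.le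
  obtain ⟨j, hj⟩ := exists_measure_inter_ne_zero hM (S := fun j : ℕ => {ω | k n ω = j})
    (.of_forall fun ω _ => ⟨_, rfl⟩)
  set B := A ∩ {ω | N y ω ≤ M} ∩ {ω | k n ω = j}
  have hB : MeasurableSet B := (hA.inter (measurableSet_le (AEEqFun.measurable _)
    measurable_const)).inter (hkm n (measurableSet_singleton j))
  have hBA : B ⊆ A := fun ω h => h.1.1
  refine hj (measure_eq_zero_iff_ae_notMem.2 ?_)
  have hfree : IsFree hE N x (Metric.closedBall (d j) ((1 / 2 : ℝ) ^ n)) B := by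
    refine ⟨hB, 2 * M, fun c hc => ?_⟩
    obtain ⟨y', hy', hle⟩ := hy.perturb hN (isIdempotentElem_chi hE hB)
      (chi_mul_chi hE hA hB hBA) (b := c • 1) (by
        filter_upwards [rep_chi hE hB, rep_smul_one (E := E) c, ha, hdist] with ω h1 h2 h3 h4 h5
        have hω : ω ∈ B := by
          by_contra h
          rw [h1, Set.indicator_of_notMem h] at h5
          exact h5 rfl
        rw [h2, h3, ← dist_eq_norm]
        have h6 := h4 n
        rw [hω.2] at h6
        have h7 := dist_triangle c (d j) (f ω)
        have h8 : N y ω ≤ M := hω.1.2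
        have h9 := Metric.mem_closedBall.1 hc
        have h10 : dist c (f ω) ≤ 5 * (1 / 2 : ℝ) ^ n := by linarith
        exact (mul_le_mul_of_nonneg_left h8 dist_nonneg).trans
          ((mul_le_mul_of_nonneg_right h10 (Nat.cast_nonneg M)).trans hn))
    refine ⟨y', hy', ?_⟩
    have h1 := ae_chi_smul (hE := hE) hN.toIsLatticeNorm hB y'
    rw [hy'.smul] at h1
    filter_upwards [h1, hle] with ω h2 h3
    by_cases h : ω ∈ B
    · have h4 : N y ω ≤ M := h.1.2
      linarith
    · rw [h2, Set.indicator_of_notMem h]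
      positivity
  filter_upwards [hkfree n j B hfree] with ω h1 h2
  exact h1 h2 h2.2

end Nonempty

/-! ### Boundedness, order closedness and cyclicity -/

section Spectrum

variable {Ω : Type*} [MeasurableSpace Ω] {μ : Measure Ω} {E : Subalgebra ℂ (Ω →ₘ[μ] ℂ)}
  {U : Type*} [Ring U] [Algebra ℂ U] [Module E U] [IsScalarTower ℂ E U]
  [IsScalarTower E U U] [SMulCommClass E U U] {N : U → Ω →ₘ[μ] ℝ}

/-- If the bound failed, `a` could be inverted by some `c` over a non-null `B` where `N (c • x)`
stays below a constant less than 1. The Neumann series then inverts `1 - c • x`, hence also `a • 1 -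
x`, over `B`. -/
theorem ae_norm_le_of_mem_spm (hE : IsFaithfulSolid E)
    (hN : IsUnitalBanachKantorovichAlgebra E N) {x : U} {a : E} (ha : a ∈ spm E x) :
    ∀ᵐ ω ∂μ, ‖rep a ω‖ ≤ N x ω := by
  have hNm : Measurable (N x : Ω → ℝ) := AEEqFun.measurable _
  have hAm : MeasurableSet {ω | N x ω < ‖rep a ω‖} := measurableSet_lt hNm (measurable_rep a).norm
  by_contra hc
  have hA0 : μ {ω | N x ω < ‖rep a ω‖} ≠ 0 := by
    simpa only [ae_iff, not_le] using hc
  -- The first condition keeps the Neumann ratio away from 1; the second keeps the inverse of `a`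
  -- bounded, hence in `E`.
  let S : ℕ → Set Ω := fun m => {ω | N x ω ≤ (1 - 1 / ((m : ℝ) + 1)) * ‖rep a ω‖} ∩
    {ω | 1 / ((m : ℝ) + 1) ≤ ‖rep a ω‖}
  have hSm : ∀ m, MeasurableSet (S m) := fun m =>
    (measurableSet_le hNm ((measurable_rep a).norm.const_mul _)).inter
      (measurableSet_le measurable_const (measurable_rep a).norm)
  obtain ⟨m, hm⟩ := exists_measure_inter_ne_zero hA0 (S := S) (by
    filter_upwards [hN.ae_nonneg x] with ω h0 h
    have h1 : N x ω < ‖rep a ω‖ := h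
    have h2 : 0 < ‖rep a ω‖ := h0.trans_lt h1
    have ht := tendsto_one_div_add_atTop_nhds_zero_nat (𝕜 := ℝ)
    have ht' : Tendsto (fun n : ℕ => (1 - 1 / ((n : ℝ) + 1)) * ‖rep a ω‖) atTop
        (nhds ((1 - 0) * ‖rep a ω‖)) := (tendsto_const_nhds.sub ht).mul_const _
    rw [sub_zero, one_mul] at ht'
    obtain ⟨n, h3, h4⟩ :=
      ((ht'.eventually_const_lt h1).and (ht.eventually_lt_const h2)).exists
    exact ⟨n, h3.le, h4.le⟩)
  set B := {ω | N x ω < ‖rep a ω‖} ∩ S m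
  have hB : MeasurableSet B := hAm.inter (hSm m)
  have hm0 : (0 : ℝ) < 1 / ((m : ℝ) + 1) := Nat.one_div_pos_of_nat
  have hm1 : 1 / ((m : ℝ) + 1) ≤ 1 := by
    rw [div_le_one (by positivity)]
    linarith [Nat.cast_nonneg (α := ℝ) m]
  obtain ⟨c, hc⟩ := hE.exists_rep_of_bdd (f := B.indicator fun ω => (rep a ω)⁻¹)
    ((measurable_rep a).inv.indicator hB).aemeasurable ((m : ℝ) + 1) (.of_forall fun ω => by
      by_cases h : ω ∈ B
      · rw [Set.indicator_of_mem h, norm_inv]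
        have h1 : 1 / ((m : ℝ) + 1) ≤ ‖rep a ω‖ := h.2.2
        exact inv_le_of_inv_le₀ (by positivity) (by rwa [← one_div])
      · rw [Set.indicator_of_notMem h, norm_zero]
        positivity)
  have hχc : chi hE hB * c = c := rep_ext (by
    filter_upwards [rep_mul (chi hE hB) c, rep_chi hE hB, hc] with ω h1 h2 h3
    rw [h1, h2, h3]
    by_cases h : ω ∈ B <;> simp [h])
  have hca : c * a = chi hE hB := rep_ext (by
    filter_upwards [rep_mul c a, rep_chi hE hB, hc] with ω h1 h2 h3
    rw [h1, h2, h3]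
    by_cases h : ω ∈ B
    · have h4 : ‖rep a ω‖ ≠ 0 := (hm0.trans_le h.2.2).ne'
      simp [h, norm_ne_zero_iff.1 h4]
    · simp [h])
  obtain ⟨v, hv⟩ := exists_invOn_one_sub hN (isIdempotentElem_chi hE hB) (u := c • x)
    (by rw [smul_smul, hχc]) (q := 1 - 1 / ((m : ℝ) + 1)) (by linarith) (by linarith) (by
      filter_upwards [hN.ae_smul c x, hc, hN.ae_nonneg x] with ω h1 h2 h3
      rw [h1, h2]
      by_cases h : ω ∈ B
      · rw [Set.indicator_of_mem h, norm_inv, inv_mul_le_iff₀ (hm0.trans_le h.2.2), mul_comm]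
        exact h.2.1
      · rw [Set.indicator_of_notMem h, norm_zero, zero_mul]
        linarith)
  refine ha _ (isIdempotentElem_chi hE hB) (chi_ne_zero hE hB hm)
    ((isInvIn_iff (isIdempotentElem_chi hE hB)).2 ⟨c • v, ?_, ?_, ?_⟩)
  · rw [smul_smul, hχc]
  · rw [← hv.mul_right, mul_smul_comm, ← smul_mul_assoc, smul_sub, smul_smul, hca, sub_mul,
      sub_mul, smul_mul_assoc, one_mul, hv.smul]
  · rw [← hv.mul_left, smul_mul_assoc, ← mul_smul_comm, smul_sub, smul_smul, hca, mul_sub,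
      mul_sub, mul_smul_comm, mul_one, hv.smul]

/-- An inverse at the limit `a` is bounded over a non-null set. Over a smaller one, some member `b`
of the net is uniformly close enough to `a` for the inverse to survive at `b`. -/
theorem isOClosed_spm (hE : IsFaithfulSolid E) (hN : IsUnitalBanachKantorovichAlgebra E N)
    (x : U) : IsOClosed E (spm E x) := by
  rintro l a hl hmem ⟨D, -, -, -, hD, hlD⟩ p hp hp0 hinv
  obtain ⟨y, hy⟩ := (isInvIn_iff hp).1 hinv
  obtain ⟨A, hA, hA0, rfl⟩ := exists_eq_chi hE hp hp0
  obtain ⟨M, hM⟩ := exists_measure_inter_ne_zero hA0 (S := fun M : ℕ => {ω | N y ω ≤ M})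
    (.of_forall fun ω _ => exists_nat_ge (N y ω))
  set A' := A ∩ {ω | N y ω ≤ M} 
  have hA' : MeasurableSet A' :=
    hA.inter (measurableSet_le (AEEqFun.measurable _) measurable_const)
  set δ : ℝ := 1 / (2 * ((M : ℝ) + 1)) with hδ
  have hδ0 : 0 < δ := by positivity
  -- Otherwise `δ` times the indicator of `A'` would be a lower bound of `D`, contradicting the
  -- infimum 0.
  obtain ⟨d, hd, hd0⟩ : ∃ d ∈ D, μ (A' ∩ {ω | d ω < δ}) ≠ 0 := by
    by_contra! hc
    have hlow : AEEqFun.mk (A'.indicator fun _ => δ)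
        (measurable_const.indicator hA').aestronglyMeasurable ≤ (0 : Ω →ₘ[μ] ℝ) := hD.2 fun d hd => by
      rw [← AEEqFun.coeFn_le]
      filter_upwards [measure_eq_zero_iff_ae_notMem.1 (hc d hd), AEEqFun.coeFn_le.2 (hD.1 hd),
        AEEqFun.coeFn_mk (μ := μ) (A'.indicator fun _ => δ)
          (measurable_const.indicator hA').aestronglyMeasurable,
        AEEqFun.coeFn_zero (α := Ω) (β := ℝ) (μ := μ)] with ω h1 h2 h3 h4
      rw [h3]
      by_cases h : ω ∈ A'
      · rw [Set.indicator_of_mem h]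
        by_contra! h5
        exact h1 ⟨h, h5⟩
      · rw [Set.indicator_of_notMem h]
        rw [h4] at h2
        exact h2
    refine hM (measure_eq_zero_iff_ae_notMem.2 ?_)
    filter_upwards [AEEqFun.coeFn_le.2 hlow, AEEqFun.coeFn_mk (μ := μ) (A'.indicator fun _ => δ)
          (measurable_const.indicator hA').aestronglyMeasurable,
        AEEqFun.coeFn_zero (α := Ω) (β := ℝ) (μ := μ)] with ω h1 h2 h3 h
    rw [h2, h3, Set.indicator_of_mem h] at h1
    exact absurd hδ0 (not_lt.2 h1)
  set B := A' ∩ {ω | d ω < δ}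
  have hB : MeasurableSet B :=
    hA'.inter (measurableSet_lt (AEEqFun.measurable _) measurable_const)
  obtain ⟨b, hb, hbd⟩ := (hmem.and (hlD d hd)).exists
  obtain ⟨y', hy', -⟩ := hy.perturb hN (isIdempotentElem_chi hE hB)
    (chi_mul_chi hE hA hB fun ω h => h.1.1) (b := b) (by
      filter_upwards [rep_chi hE hB, AEEqFun.coeFn_le.2 hbd, coeFn_modulus_rep (b - a),
        rep_sub b a] with ω h1 h2 h3 h4 h5
      have hω : ω ∈ B := by
        by_contra h
        rw [h1, Set.indicator_of_notMem h] at h5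
        exact h5 rfl
      rw [h3, h4] at h2
      have h6 : d ω < δ := hω.2
      have h7 : N y ω ≤ M := hω.1.2
      calc ‖rep b ω - rep a ω‖ * N y ω ≤ δ * ((M : ℝ) + 1) :=
            (mul_le_mul_of_nonneg_left (h7.trans (lt_add_one _).le) (norm_nonneg _)).trans
              (mul_le_mul_of_nonneg_right (h2.trans h6.le) (by positivity))
        _ = 1 / 2 := by rw [hδ]; field_simp)
  exact hb _ (isIdempotentElem_chi hE hB) (chi_ne_zero hE hB hd0)
    ((isInvIn_iff (isIdempotentElem_chi hE hB)).2 ⟨y', hy'⟩)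

/-- The relations of a partition of unity hold almost everywhere. -/
lemma IsPartitionOfUnity.ae_exists_eq (hE : IsFaithfulSolid E) {p : ℕ → E}
    (hp : IsPartitionOfUnity E p) :
    ∀ᵐ ω ∂μ, ∃ n, rep (p n) ω = 1 ∧ ∀ m, m ≠ n → rep (p m) ω = 0 := by
  have h01 : ∀ᵐ ω ∂μ, ∀ n, rep (p n) ω = 0 ∨ rep (p n) ω = 1 := ae_all_iff.2 fun n => by
    filter_upwards [rep_mul (p n) (p n)] with ω h
    rw [(hp.orthogonal.idem n).eq] at h
    rcases eq_or_ne (rep (p n) ω) 0 with h0 | h0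
    · exact Or.inl h0
    · exact Or.inr (mul_left_cancel₀ h0 (by rw [← h, mul_one]))
  have hort : ∀ᵐ ω ∂μ, ∀ n m, n ≠ m → rep (p n) ω * rep (p m) ω = 0 :=
    ae_all_iff.2 fun n => ae_all_iff.2 fun m => by
      by_cases h : n = m
      · exact .of_forall fun ω h' => absurd h h'
      · filter_upwards [rep_mul (p n) (p m), rep_zero (E := E)] with ω h1 h2 _
        rw [← h1, hp.orthogonal.ortho h, h2]
  have hQ : MeasurableSet {ω | ∃ n, rep (p n) ω = 1} := by
    simp only [Set.ofPred_exists]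
    exact MeasurableSet.iUnion fun n => measurable_rep (p n) (measurableSet_singleton 1)
  -- The indicator of the set where some `p n` equals 1 dominates every `p n`, so it is the unit.
  have hone := hp.sup_eq_one (chi hE hQ) (isIdempotentElem_chi hE hQ) fun n => rep_ext (by
    filter_upwards [rep_mul (p n) (chi hE hQ), rep_chi hE hQ, h01] with ω h1 h2 h3
    rw [h1, h2]
    rcases h3 n with h | h
    · rw [h, zero_mul]
    · rw [Set.indicator_of_mem (show ω ∈ {ω | ∃ n, rep (p n) ω = 1} from ⟨n, h⟩), Pi.one_apply,
        mul_one])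
  filter_upwards [rep_chi hE hQ, rep_one (E := E), h01, hort] with ω h1 h2 h3 h4
  rw [hone, h2] at h1
  have hω : ω ∈ {ω | ∃ n, rep (p n) ω = 1} := by
    by_contra h
    rw [Set.indicator_of_notMem h] at h1
    exact one_ne_zero h1
  obtain ⟨n, hn⟩ := hω
  refine ⟨n, hn, fun m hm => ?_⟩
  have h5 := h4 m n hm
  rwa [hn, mul_one] at h5

/-- Bounded sequences in `E` can be mixed along a partition of unity. -/
lemma exists_mixing (hE : IsFaithfulSolid E) {p a : ℕ → E} (hp : IsPartitionOfUnity E p) (g : E)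
    (ha : ∀ n, ∀ᵐ ω ∂μ, ‖rep (a n) ω‖ ≤ ‖rep g ω‖) :
    ∃ b : E, (∀ n, p n * b = p n * a n) ∧
      OTendsto E (fun k => ∑ n ∈ Finset.range k, p n * a n) atTop b := by
  have hpart := hp.ae_exists_eq hE
  have ha' := ae_all_iff.2 ha
  have hsum : ∀ᵐ ω ∂μ, ∀ k, rep (∑ n ∈ Finset.range k, p n * a n) ω =
      ∑ n ∈ Finset.range k, rep (p n) ω * rep (a n) ω := ae_all_iff.2 fun k => by
    have h : ∀ᵐ ω ∂μ, ∀ n, rep (p n * a n) ω = rep (p n) ω * rep (a n) ω :=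
      ae_all_iff.2 fun n => rep_mul _ _
    filter_upwards [rep_finset_sum (Finset.range k) fun n => p n * a n, h] with ω h1 h2
    rw [h1]
    exact Finset.sum_congr rfl fun n _ => h2 n
  -- At almost every point exactly one summand is active, so the partial sums are 0 up to its index
  -- and constant afterwards.
  have hval : ∀ᵐ ω ∂μ, ∃ n, rep (p n) ω = 1 ∧ (∀ m, m ≠ n → rep (p m) ω = 0) ∧
      ∀ k, rep (∑ i ∈ Finset.range k, p i * a i) ω = if n < k then rep (a n) ω else 0 := by
    filter_upwards [hpart, hsum] with ω h1 h2
    obtain ⟨n, hn, hm⟩ := h1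
    refine ⟨n, hn, hm, fun k => ?_⟩
    have h3 : ∀ i, rep (p i) ω * rep (a i) ω = if n = i then rep (a n) ω else 0 := fun i => by
      split_ifs with h
      · rw [← h, hn, one_mul]
      · rw [hm i (Ne.symm h), zero_mul]
    rw [h2]
    simp only [h3, Finset.sum_ite_eq, Finset.mem_range]
  have hlim : ∀ᵐ ω ∂μ, ∃ z, Tendsto (fun k => rep (∑ i ∈ Finset.range k, p i * a i) ω) atTop
      (nhds z) := by
    filter_upwards [hval] with ω h
    obtain ⟨n, -, -, h1⟩ := h
    refine ⟨rep (a n) ω, tendsto_const_nhds.congr' ?_⟩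
    filter_upwards [eventually_gt_atTop n] with k hk
    rw [h1, if_pos hk]
  obtain ⟨f, hfm, hf⟩ := measurable_limit_of_tendsto_metrizable_ae (μ := μ) (L := atTop)
    (fun k => (measurable_rep (∑ i ∈ Finset.range k, p i * a i)).aemeasurable) hlim
  have hfval : ∀ᵐ ω ∂μ, ∃ n, rep (p n) ω = 1 ∧ (∀ m, m ≠ n → rep (p m) ω = 0) ∧
      f ω = rep (a n) ω ∧
      ∀ k, rep (∑ i ∈ Finset.range k, p i * a i) ω = if n < k then f ω else 0 := by
    filter_upwards [hval, hf] with ω h h2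
    obtain ⟨n, hn, hm, h1⟩ := h
    have h3 : f ω = rep (a n) ω := tendsto_nhds_unique h2 (tendsto_const_nhds.congr' (by
      filter_upwards [eventually_gt_atTop n] with k hk
      rw [h1, if_pos hk]))
    exact ⟨n, hn, hm, h3, by rwa [h3]⟩
  obtain ⟨b, hb⟩ := hE.exists_rep hfm.aemeasurable g (by
    filter_upwards [hfval, ha'] with ω h h2
    obtain ⟨n, -, -, h1, -⟩ := h
    rw [h1]
    exact h2 n)
  refine ⟨b, fun n => rep_ext ?_, ?_⟩
  · filter_upwards [rep_mul (p n) b, rep_mul (p n) (a n), hb, hfval] with ω h1 h2 h3 h4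
    obtain ⟨i, hi, hm, h5, -⟩ := h4
    rw [h1, h2, h3, h5]
    rcases eq_or_ne n i with rfl | h
    · rfl
    · rw [hm n h, zero_mul, zero_mul]
  -- The moduli of the remainders decrease and eventually vanish at almost every point, so their
  -- range serves as the dominating set `D`.
  · set s : ℕ → Ω →ₘ[μ] ℝ := fun k =>
      modulus ((∑ n ∈ Finset.range k, p n * a n - b : E) : Ω →ₘ[μ] ℂ)
    have hsval : ∀ᵐ ω ∂μ, ∃ n, ∀ k, s k ω = if n < k then 0 else ‖f ω‖ := by
      have h1 : ∀ᵐ ω ∂μ, ∀ k, s k ω = ‖rep (∑ n ∈ Finset.range k, p n * a n) ω - f ω‖ :=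
        ae_all_iff.2 fun k => by
          filter_upwards [coeFn_modulus_rep (∑ n ∈ Finset.range k, p n * a n - b),
            rep_sub (∑ n ∈ Finset.range k, p n * a n) b, hb] with ω h1 h2 h3
          rw [← h3, ← h2]
          exact h1
      filter_upwards [h1, hfval] with ω h2 h3
      obtain ⟨n, -, -, -, h4⟩ := h3
      refine ⟨n, fun k => ?_⟩
      rw [h2, h4]
      split_ifs <;> simp
    have hanti : ∀ i j, i ≤ j → s j ≤ s i := fun i j hij => by
      rw [← AEEqFun.coeFn_le]
      filter_upwards [hsval] with ω h
      obtain ⟨n, h⟩ := h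
      rw [h, h]
      split_ifs with h1 h2
      · exact le_rfl
      · exact norm_nonneg _
      · omega
      · exact le_rfl
    refine ⟨Set.range s, Set.range_nonempty s, ?_, ?_, isGLB_zero_of_ae ?_ (fun n => ⟨n, rfl⟩) ?_,
      ?_⟩
    · rintro _ ⟨i, rfl⟩ _ ⟨j, rfl⟩
      exact ⟨_, ⟨max i j, rfl⟩, hanti _ _ (le_max_left _ _), hanti _ _ (le_max_right _ _)⟩
    · rintro _ ⟨k, rfl⟩
      refine hE.solid _ ((∑ n ∈ Finset.range k, p n * a n - b : E) : Ω →ₘ[μ] ℂ) (le_of_eq ?_)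
        (Subtype.property _)
      refine AEEqFun.ext ?_
      filter_upwards [coeFn_modulus (toComplex (s k)), coeFn_toComplex (s k),
        coeFn_modulus ((∑ n ∈ Finset.range k, p n * a n - b : E) : Ω →ₘ[μ] ℂ)] with ω h1 h2 h3
      rw [h1, h2, Complex.norm_real, h3, norm_norm]
    · rintro _ ⟨k, rfl⟩
      rw [← AEEqFun.coeFn_le]
      filter_upwards [hsval, AEEqFun.coeFn_zero (α := Ω) (β := ℝ) (μ := μ)] with ω h h0
      obtain ⟨n, h⟩ := h
      rw [h, h0]
      split_ifs
      · exact le_rfl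
      · exact norm_nonneg _
    · filter_upwards [hsval] with ω h
      obtain ⟨n, h⟩ := h
      refine tendsto_const_nhds.congr' ?_
      filter_upwards [eventually_gt_atTop n] with k hk
      rw [h, if_pos hk]
    · rintro _ ⟨k, rfl⟩
      filter_upwards [eventually_ge_atTop k] with j hj
      exact hanti k j hj

/-- The norm bound makes `N x` dominate all the `a n`, so the mixture `b` exists in `E`. A nonzero
`q` meets some `p n`, and over `p n * q` the elements `b` and `a n` agree, so invertibility at `b`
would pass to `a n`. -/
theorem isCyclicSet_spm (hE : IsFaithfulSolid E) (hN : IsUnitalBanachKantorovichAlgebra E N)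
    (x : U) : IsCyclicSet E (spm E x) := by
  intro a p ha hp
  obtain ⟨b, hb, hlim⟩ := exists_mixing hE (a := a) hp (⟨_, hN.mem x⟩ : E) fun n => by
    filter_upwards [ae_norm_le_of_mem_spm hE hN (ha n), coeFn_toComplex (N x)] with ω h1 h2
    have h3 : rep (⟨_, hN.mem x⟩ : E) ω = (N x ω : ℂ) := h2
    rw [h3, Complex.norm_real]
    exact h1.trans (le_abs_self _)
  refine ⟨b, fun q hq hq0 hinv => ?_, hlim⟩
  obtain ⟨y, hy⟩ := (isInvIn_iff hq).1 hinv
  obtain ⟨n, hn⟩ : ∃ n, p n * q ≠ 0 := by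
    by_contra! hc
    have h1 := hp.sup_eq_one (1 - q) hq.one_sub fun n => by rw [mul_sub, mul_one, hc, sub_zero]
    exact hq0 (by rwa [sub_eq_self] at h1)
  have hidem : IsIdempotentElem (p n * q) := (hp.orthogonal.idem n).mul hq
  refine ha n (p n * q) hidem hn ?_
  have h1 := (isInvIn_iff hidem).2 ⟨_, hy.mono hidem (by rw [mul_assoc, hq.eq])⟩
  have h2 : (p n * q) • (b • (1 : U) - x) = (p n * q) • (a n • (1 : U) - x) := by
    have h3 : p n * q * b = p n * q * a n := by
      rw [mul_right_comm, hb, mul_right_comm]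
    rw [smul_sub, smul_sub, smul_smul, smul_smul, h3]
  rwa [h2] at h1

end Spectrum

end BanachKantorovich

end

theorem theorem2p5 {Ω : Type*} [MeasurableSpace Ω] (μ : MeasureTheory.Measure Ω)
    [MeasureTheory.IsFiniteMeasure μ] (E : Subalgebra ℂ (Ω →ₘ[μ] ℂ))
    (hE : BanachKantorovich.IsFaithfulSolid E)
    {U : Type*} [Ring U] [Algebra ℂ U] [Module E U] [IsScalarTower ℂ E U]
    [IsScalarTower E U U] [SMulCommClass E U U] (N : U → Ω →ₘ[μ] ℝ)
    (hN : BanachKantorovich.IsUnitalBanachKantorovichAlgebra E N) (x : U) :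
    (BanachKantorovich.spm E x).Nonempty ∧
    BanachKantorovich.IsOClosed E (BanachKantorovich.spm E x) ∧
    BanachKantorovich.IsCyclicSet E (BanachKantorovich.spm E x) ∧
    ∀ a ∈ BanachKantorovich.spm E x,
      BanachKantorovich.modulus (a : Ω →ₘ[μ] ℂ) ≤ N x := by
  exact ⟨BanachKantorovich.spm_nonempty hE hN x, BanachKantorovich.isOClosed_spm hE hN x,
    BanachKantorovich.isCyclicSet_spm hE hN x, fun a ha => by
      rw [← MeasureTheory.AEEqFun.coeFn_le]
      filter_upwards [BanachKantorovich.coeFn_modulus_rep a,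
        BanachKantorovich.ae_norm_le_of_mem_spm hE hN ha] with ω h1 h2
      rw [h1]
      exact h2⟩
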